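/- Let $\mathcal C[0,1]$ be the space of continuous maps of $[0,1]$ to itself with the uniform topology; a property of maps is *typical* if it holds for all $f$ in some dense $G_\delta$ subset of $\mathcal C[0,1]$. Let the space of Borel probability measures on $[0,1]$ carry the weak$^*$ topology, fix a sequence $(\Psi_i)_{i\ge 1}$ dense in $\mathcal C[0,1]$, and put $\mathrm{dist}(\mu,\nu)=\sum_{i\ge 1}2^{-i}\left|\int\Psi_i\,d\mu-\int\Psi_i\,d\nu\right|$. For $f\in\mathcal C[0,1]$ let $\mathcal M_f$ be the set of $f$-invariant Borel probability measures, let $h_\mu(f)\in[0,+\infty]$ be the metric (Kolmogorov–Sinai) entropy, and let $p\omega(x)$ be the set of weak$^*$ limits of convergent subsequences of $\frac1n\sum_{j=0}^{n-1}\delta_{f^j(x)}$. A probability measure $\mu$ is *pseudo-physical* for $f$ if for every $\varepsilon>0$ the set $\{x\in[0,1]:\mathrm{dist}(p\omega(x),\mu)<\varepsilon\}$ has positive Lebesgue measure; $\mathcal O_f$ is the set of these measures. A *periodic measure* is $\frac1p\sum_{j=0}^{p-1}\delta_{f^j(x)}$ with $x$ periodic of period $p$. For $m\ge 2$, call $\mu\in\mathcal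 M_f$ a *Bernoulli measure on $m$ symbols* if $(f,\mu)$ is isomorphic (mod $0$) to the one-sided shift on $\{1,\dots,m\}^{\mathbb N}$ with the product of the uniform measures. The following holds for a typical map $f\in\mathcal C[0,1]$. 1. The entropy function $\mu\in\mathcal M_f\mapsto h_\mu(f)\in[0,+\infty]$ is neither upper nor lower semicontinuous. 2. $\mathcal O_f\subset\mathcal M_f$, and the restriction of the entropy function to $\mathcal O_f$ is neither upper nor lower semicontinuous. 3. For every fixed point $x_0$ of $f$, the Dirac measure $\delta_{x_0}$ is pseudo-physical, and for every $m\ge 2$ it is the weak$^*$ limit of a sequence of Bernoulli measures on $m$ symbols. 4. For every $m\ge 2$, every Bernoulli measure on $m$ symbols has entropy $\log m$, is pseudo-physical, and is the weak$^*$ limit of a sequence of pseudo-physical periodic measures. -/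

import Mathlib

open Set Filter Topology MeasureTheory

noncomputable section

namespace IntervalMaps

/-- The space of continuous maps of `[0,1]` to itself, with the topology of uniform convergence. -/
abbrev Maps : Type := C(unitInterval, unitInterval)

/-- The Borel probability measures on `[0,1]`, with the weak* topology. -/
abbrev Measures : Type := ProbabilityMeasure unitInterval

/-- A property of maps is typical if it holds on some dense `G_δ` subset of the space of maps. -/
def IsTypical (P : Maps → Prop) : Prop :=
  ∃ G : Set Maps, IsGδ G ∧ Dense G ∧ ∀ f ∈ G, P f

/-- The set `M_f` of `f`-invariant Borel probability measures. -/
def invariantMeasures (f : Maps) : Set Measures :=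
  {μ | MeasurePreserving f (μ : Measure unitInterval) (μ : Measure unitInterval)}

/-- The measure `(1 / (n + 1)) ∑_{j = 0}^{n} δ_{f^j x}`: there are `n + 1` points, so `n` runs
over all natural numbers. -/
def empirical (f : Maps) (x : unitInterval) (n : ℕ) : Measures :=
  ⟨((n + 1 : ℕ) : ENNReal)⁻¹ • ∑ j ∈ Finset.range (n + 1), Measure.dirac (f^[j] x), ⟨by
    simp only [Measure.smul_apply, Measure.finsetSum_apply, measure_univ, Finset.sum_const,
      Finset.card_range, nsmul_eq_mul, mul_one, smul_eq_mul]
    exact ENNReal.inv_mul_cancel (by simp) (ENNReal.natCast_ne_top _)⟩⟩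

/-- The set `pω(x)` of the weak* limits of the convergent subsequences of the empirical measures
along the orbit of `x`. -/
def limitMeasures (f : Maps) (x : unitInterval) : Set Measures :=
  {ν | ∃ φ : ℕ → ℕ, StrictMono φ ∧ Tendsto (fun k => empirical f x (φ k)) atTop (𝓝 ν)}

/-- The distance `∑_{i ≥ 1} 2^{-i} |∫ Ψ_i dμ - ∫ Ψ_i dν|` (the sequence is indexed from `0`
here). The terms are at most `2^{-i}`, so the series converges. -/
def weakDist (Ψ : ℕ → Maps) (μ ν : Measures) : ℝ :=
  ∑' i : ℕ, (1 / 2 : ℝ) ^ (i + 1) *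
    |(∫ x, (Ψ i x : ℝ) ∂(μ : Measure unitInterval)) -
      ∫ x, (Ψ i x : ℝ) ∂(ν : Measure unitInterval)|

/-- The set `A_ε(μ)` of the points `x` with `dist(pω(x), μ) < ε`; the distance to the set
`pω(x)` is an infimum, so it is less than `ε` iff some element is at distance less than `ε`. -/
def basin (Ψ : ℕ → Maps) (f : Maps) (μ : Measures) (ε : ℝ) : Set unitInterval :=
  {x | ∃ ν ∈ limitMeasures f x, weakDist Ψ ν μ < ε}

/-- The set `O_f` of pseudo-physical measures: each `A_ε(μ)` has positive Lebesgue measure. -/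
def pseudoPhysical (Ψ : ℕ → Maps) (f : Maps) : Set Measures :=
  {μ | ∀ ε : ℝ, 0 < ε → 0 < volume (basin Ψ f μ ε)}

/-- The entropy `H_μ(⋁_{j < n} f^{-j} ξ)` of the `n`-th refinement of the finite partition
`{ξ⁻¹(i)}`: a finite measurable partition is given by its labelling map `ξ`. -/
def partitionEntropy (f : Maps) (μ : Measures) {k : ℕ} (ξ : unitInterval → Fin k) (n : ℕ) : ℝ :=
  ∑ w : Fin n → Fin k,
    Real.negMulLog ((μ : Measure unitInterval).real {x | ∀ j : Fin n, ξ (f^[(j : ℕ)] x) = w j})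

/-- The metric (Kolmogorov–Sinai) entropy `h_μ(f) ∈ [0, ∞]`: the supremum over finite measurable
partitions of `lim (1/n) H_μ(⋁_{j < n} f^{-j} ξ)`. For invariant `μ` the limit exists by
subadditivity, so that it is the upper limit. -/
def entropy (f : Maps) (μ : Measures) : ENNReal :=
  ⨆ (k : ℕ) (ξ : unitInterval → Fin k) (_ : Measurable ξ),
    limsup (fun n : ℕ => ENNReal.ofReal (partitionEntropy f μ ξ n / n)) atTop

/-- The set `Per_f` of the measures equidistributed on a periodic orbit. -/
def periodicMeasures (f : Maps) : Set Measures :=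
  {μ | ∃ (x : unitInterval) (n : ℕ), Function.minimalPeriod f x = n + 1 ∧ μ = empirical f x n}

/-- The uniform Bernoulli measure: the product over `ℕ` of the uniform measure on `m` symbols. -/
def uniformBernoulli (m : ℕ) [NeZero m] : Measure (ℕ → Fin m) :=
  Measure.infinitePi fun _ : ℕ => (PMF.uniformOfFintype (Fin m)).toMeasure

/-- `μ` is `f`-invariant and `(f, μ)` is isomorphic (mod `0`) to the one-sided shift on `m`
symbols with the uniform Bernoulli measure: `φ` is the isomorphism and `ψ` its inverse. -/
def IsBernoulli (f : Maps) (m : ℕ) [NeZero m] (μ : Measures) : Prop :=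
  μ ∈ invariantMeasures f ∧
    ∃ (φ : unitInterval → ℕ → Fin m) (ψ : (ℕ → Fin m) → unitInterval),
      MeasurePreserving φ (μ : Measure unitInterval) (uniformBernoulli m) ∧ Measurable ψ ∧
      (∀ᵐ x ∂(μ : Measure unitInterval), φ (f x) = fun i => φ x (i + 1)) ∧
      (∀ᵐ x ∂(μ : Measure unitInterval), ψ (φ x) = x) ∧
      (∀ᵐ ω ∂(uniformBernoulli m), φ (ψ ω) = ω)

end IntervalMaps

end

noncomputable section

namespace IntervalMaps

/-! ### The distance between measures -/

/-! If `A` is open, then `A ∪ (closure A)ᶜ` is open and dense. Hence, for countably many open sets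
of maps, a typical `f` belongs to each one whose closure contains it: every robust phenomenon on the
list that arbitrarily small perturbations can create is already present in `f`. The property
`IsRich` applies this to two kinds of phenomena.

Attracting balls. If an injective orbit segment nearly returns to its start and its empirical
measure is near `μ`, a small perturbation closes it and then flattens the map near the starting
point, so that a whole ball returns into itself along that orbit (`exists_mem_attracting`). In such
a ball every point has a limit measure near `μ` (`volume_basin_pos`), and the return map has a fixed
point (`exists_periodic_of_mem_attracting`). So each measure approximated by nearly closed orbit
segments (`IsClosable`) is pseudo-physical and a limit of periodic measures. Periodic measures are
trivially closable. Bernoulli measures are closable by the mean ergodic theorem, recurrence and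
almost sure injectivity of orbits (`isClosable_of_ergodic`).

Horseshoes. Near a fixed point a small perturbation makes the map oscillate over a short interval,
giving `m` disjoint intervals each stretched across all of them (`mem_closure_horseshoes`). Such a
horseshoe carries a Bernoulli measure on `m` symbols (`IsHorseshoe.exists_isBernoulli`), so
Bernoulli measures accumulate at the Dirac measure of every fixed point.

Periodic measures have entropy zero and Bernoulli measures have entropy `log m`. A Dirac measure at
a fixed point is a limit of Bernoulli measures, which refutes upper semicontinuity; a Bernoulli
measure is a limit of periodic ones, which refutes lower semicontinuity. All these measures are
pseudo-physical, hence invariant, so the same sequences serve both domains. -/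

theorem integral_empirical (f : Maps) (x : unitInterval) (n : ℕ) (g : unitInterval → ℝ) :
    ∫ y, g y ∂(empirical f x n : Measure unitInterval) =
      (n + 1 : ℝ)⁻¹ * ∑ j ∈ Finset.range (n + 1), g (f^[j] x) := by
  change ∫ y, g y ∂(((n + 1 : ℕ) : ENNReal)⁻¹ •
    ∑ j ∈ Finset.range (n + 1), Measure.dirac (f^[j] x)) = _
  rw [integral_smul_measure, integral_finsetSum_measure]
  · simp [integral_dirac]
    left
    norm_cast
  · intro i _
    exact integrable_dirac (by simp)

theorem integrable_coe (g : Maps) (μ : Measures) :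
    Integrable (fun x => (g x : ℝ)) (μ : Measure unitInterval) :=
  (continuous_subtype_val.comp g.continuous).integrable_of_hasCompactSupport
    (HasCompactSupport.of_compactSpace _)

theorem integral_coe_mem (g : Maps) (μ : Measures) :
    ∫ x, (g x : ℝ) ∂(μ : Measure unitInterval) ∈ Icc (0 : ℝ) 1 := by
  constructor
  · exact integral_nonneg fun x => (g x).2.1
  · calc ∫ x, (g x : ℝ) ∂(μ : Measure unitInterval)
        ≤ ∫ _, (1 : ℝ) ∂(μ : Measure unitInterval) :=
          integral_mono (integrable_coe g μ) (integrable_const _) fun x => (g x).2.2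
      _ = 1 := by simp

theorem weakDist_term_le (g : Maps) (μ ν : Measures) (i : ℕ) :
    (1 / 2 : ℝ) ^ (i + 1) * |(∫ x, (g x : ℝ) ∂(μ : Measure unitInterval)) -
      ∫ x, (g x : ℝ) ∂(ν : Measure unitInterval)| ≤ (1 / 2 : ℝ) ^ (i + 1) := by
  have h1 := integral_coe_mem g μ
  have h2 := integral_coe_mem g ν
  have : |(∫ x, (g x : ℝ) ∂(μ : Measure unitInterval)) -
      ∫ x, (g x : ℝ) ∂(ν : Measure unitInterval)| ≤ 1 := by
    rw [abs_le]; constructor <;> linarith [h1.1, h1.2, h2.1, h2.2]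
  exact mul_le_of_le_one_right (by positivity) this

theorem summable_half_pow : Summable fun i : ℕ => (1 / 2 : ℝ) ^ (i + 1) :=
  (summable_nat_add_iff 1).2 (summable_geometric_of_lt_one (by norm_num) (by norm_num))

variable (Ψ : ℕ → Maps)

theorem summable_weakDist (μ ν : Measures) :
    Summable fun i : ℕ => (1 / 2 : ℝ) ^ (i + 1) *
      |(∫ x, (Ψ i x : ℝ) ∂(μ : Measure unitInterval)) -
        ∫ x, (Ψ i x : ℝ) ∂(ν : Measure unitInterval)| :=
  Summable.of_nonneg_of_le (fun _ => by positivity) (fun i => weakDist_term_le (Ψ i) μ ν i)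
    summable_half_pow

theorem weakDist_nonneg (μ ν : Measures) : 0 ≤ weakDist Ψ μ ν :=
  tsum_nonneg fun _ => by positivity

theorem weakDist_self (μ : Measures) : weakDist Ψ μ μ = 0 := by simp [weakDist]

theorem weakDist_comm (μ ν : Measures) : weakDist Ψ μ ν = weakDist Ψ ν μ := by
  simp only [weakDist, abs_sub_comm]

theorem weakDist_triangle (μ ν ρ : Measures) :
    weakDist Ψ μ ρ ≤ weakDist Ψ μ ν + weakDist Ψ ν ρ := by
  unfold weakDist
  rw [← (summable_weakDist Ψ μ ν).tsum_add (summable_weakDist Ψ ν ρ)]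
  refine (summable_weakDist Ψ μ ρ).tsum_le_tsum (fun i => ?_)
    ((summable_weakDist Ψ μ ν).add (summable_weakDist Ψ ν ρ))
  rw [← mul_add]
  exact mul_le_mul_of_nonneg_left (abs_sub_le _ _ _) (by positivity)

/-- Weierstrass M-test with the bounds `2^{-(i+1)}`. The parameter space is left general so that it
can be measures, points, or pairs of a map and a point. -/
theorem continuous_weakDist_of_continuous {X : Type*} [TopologicalSpace X] (F : X → Measures)
    (ν : Measures)
    (hF : ∀ i, Continuous fun x => ∫ y, (Ψ i y : ℝ) ∂(F x : Measure unitInterval)) :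
    Continuous fun x => weakDist Ψ (F x) ν := by
  refine continuous_tsum (fun i => ?_) summable_half_pow (fun i x => ?_)
  · exact continuous_const.mul ((hF i).sub continuous_const).abs
  · rw [Real.norm_of_nonneg (by positivity)]
    exact weakDist_term_le (Ψ i) (F x) ν i

theorem continuous_integral_measures {g : unitInterval → ℝ} (hg : Continuous g) :
    Continuous fun μ : Measures => ∫ y, g y ∂(μ : Measure unitInterval) := by
  refine continuous_iff_continuousAt.2 fun μ => ?_
  exact (ProbabilityMeasure.tendsto_iff_forall_integral_tendsto.1
    (tendsto_id : Tendsto id (𝓝 μ) (𝓝 μ))) (BoundedContinuousFunction.mkOfCompact ⟨g, hg⟩)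

theorem continuous_weakDist (ν : Measures) : Continuous fun μ => weakDist Ψ μ ν :=
  continuous_weakDist_of_continuous Ψ id ν fun i =>
    continuous_integral_measures (continuous_subtype_val.comp (Ψ i).continuous)

theorem measures_ext {μ ν : Measures}
    (h : ∀ g : C(unitInterval, ℝ), ∫ x, g x ∂(μ : Measure unitInterval) =
      ∫ x, g x ∂(ν : Measure unitInterval)) : μ = ν := by
  have : (μ : Measure unitInterval) = (ν : Measure unitInterval) :=
    ext_of_forall_integral_eq_of_IsFiniteMeasure fun g => h g.toContinuousMap
  exact Subtype.ext this

theorem abs_integral_sub_le (g h : unitInterval → ℝ) (hg : Continuous g) (hh : Continuous h)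
    {c : ℝ} (hc : ∀ x, |g x - h x| ≤ c) (μ : Measures) :
    |∫ x, g x ∂(μ : Measure unitInterval) - ∫ x, h x ∂(μ : Measure unitInterval)| ≤ c := by
  have ig := hg.integrable_of_hasCompactSupport (μ := (μ : Measure unitInterval))
    (HasCompactSupport.of_compactSpace _)
  have ih := hh.integrable_of_hasCompactSupport (μ := (μ : Measure unitInterval))
    (HasCompactSupport.of_compactSpace _)
  rw [← integral_sub ig ih]
  have := norm_integral_le_of_norm_le_const (μ := (μ : Measure unitInterval))
    (f := fun x => g x - h x) (C := c) (Eventually.of_forall hc)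
  simpa using this

variable {Ψ}

theorem integral_maps_eq_of_weakDist_eq_zero (hΨ : DenseRange Ψ) {μ ν : Measures}
    (h : weakDist Ψ μ ν = 0) (g : Maps) :
    ∫ x, (g x : ℝ) ∂(μ : Measure unitInterval) = ∫ x, (g x : ℝ) ∂(ν : Measure unitInterval) := by
  have hi : ∀ i, ∫ x, (Ψ i x : ℝ) ∂(μ : Measure unitInterval) =
      ∫ x, (Ψ i x : ℝ) ∂(ν : Measure unitInterval) := by
    intro i
    have hs := (summable_weakDist Ψ μ ν).hasSum
    rw [show (∑' _, _) = (0 : ℝ) from h] at hs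
    have h0 := (hasSum_zero_iff_of_nonneg (fun i => by positivity)).1 hs
    have := congrFun h0 i
    simp only [Pi.zero_apply, mul_eq_zero, abs_eq_zero, sub_eq_zero] at this
    exact this.resolve_left (by positivity)
  refine eq_of_forall_dist_le fun ε hε => ?_
  obtain ⟨i, hi'⟩ := hΨ.exists_dist_lt g (half_pos hε)
  have hc : ∀ x, |(g x : ℝ) - (Ψ i x : ℝ)| ≤ ε / 2 := fun x =>
    ((ContinuousMap.dist_apply_le_dist x).trans hi'.le)
  have h1 := abs_integral_sub_le _ _ (continuous_subtype_val.comp g.continuous)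
    (continuous_subtype_val.comp (Ψ i).continuous) hc μ
  have h2 := abs_integral_sub_le _ _ (continuous_subtype_val.comp g.continuous)
    (continuous_subtype_val.comp (Ψ i).continuous) hc ν
  simp only [Function.comp_def] at h1 h2
  rw [hi i] at h1
  rw [Real.dist_eq]
  rw [abs_le] at *
  constructor <;> linarith [h1.1, h1.2, h2.1, h2.2]

theorem eq_of_weakDist_eq_zero (hΨ : DenseRange Ψ) {μ ν : Measures} (h : weakDist Ψ μ ν = 0) :
    μ = ν := by
  refine measures_ext fun g => ?_
  set M : ℝ := ‖g‖ + 1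
  have hM : 0 < M := by positivity
  have hb : ∀ x, |g x| ≤ M := fun x => (g.norm_coe_le_norm x).trans (by simp [M])
  -- `Ψ` is dense only among functions with values in `[0,1]`, so `g` is rescaled affinely into that
  -- range; the `+ 1` in `M` keeps the denominator positive when `g = 0`.
  let G : Maps := ⟨fun x => ⟨(g x + M) / (2 * M), by
    have := abs_le.1 (hb x)
    constructor
    · exact div_nonneg (by linarith) (by linarith)
    · rw [div_le_one (by linarith)]; linarith⟩, by fun_prop⟩
  have hG : ∀ x, g x = 2 * M * (G x : ℝ) - M := by
    intro x
    change g x = 2 * M * ((g x + M) / (2 * M)) - M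
    field_simp; ring
  have key := integral_maps_eq_of_weakDist_eq_zero hΨ h G
  simp_rw [hG]
  rw [integral_sub ((integrable_coe G μ).const_mul _) (integrable_const _),
    integral_sub ((integrable_coe G ν).const_mul _) (integrable_const _),
    integral_const_mul, integral_const_mul, key]
  simp

/-- The space of measures is compact, so the continuous function `weakDist Ψ · μ`, which vanishes
only at `μ`, has a positive minimum on the closed complement of an open neighbourhood. -/
theorem exists_weakDist_lt_subset (hΨ : DenseRange Ψ) {μ : Measures} {U : Set Measures}
    (hU : U ∈ 𝓝 μ) : ∃ ε > 0, ∀ ν, weakDist Ψ ν μ < ε → ν ∈ U := by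
  obtain ⟨V, hVU, hV, hμ⟩ := mem_nhds_iff.1 hU
  by_cases hne : (Vᶜ).Nonempty
  · obtain ⟨ρ, hρ, hmin⟩ := (hV.isClosed_compl.isCompact).exists_isMinOn hne
      (continuous_weakDist Ψ μ).continuousOn
    refine ⟨weakDist Ψ ρ μ, ?_, fun ν hν => hVU ?_⟩
    · refine lt_of_le_of_ne (weakDist_nonneg Ψ _ _) fun h => hρ ?_
      rw [eq_of_weakDist_eq_zero hΨ h.symm]; exact hμ
    · by_contra hν'
      exact absurd (hmin hν') (not_le.2 hν)
  · rw [not_nonempty_iff_eq_empty, compl_empty_iff] at hne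
    exact ⟨1, one_pos, fun ν _ => hVU (hne ▸ mem_univ ν)⟩

theorem tendsto_of_weakDist (hΨ : DenseRange Ψ) {μ : Measures} {ν : ℕ → Measures}
    (h : Tendsto (fun n => weakDist Ψ (ν n) μ) atTop (𝓝 0)) : Tendsto ν atTop (𝓝 μ) := by
  intro U hU
  obtain ⟨ε, hε, hεU⟩ := exists_weakDist_lt_subset hΨ hU
  exact (h.eventually (gt_mem_nhds hε)).mono fun n hn => hεU _ hn

theorem exists_seq_tendsto_of_weakDist (hΨ : DenseRange Ψ) {S : Set Measures} {μ : Measures}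
    (h : ∀ ε > 0, ∃ ν ∈ S, weakDist Ψ ν μ < ε) :
    ∃ ν : ℕ → Measures, (∀ n, ν n ∈ S) ∧ Tendsto ν atTop (𝓝 μ) := by
  choose ν hν hd using h
  have hp : ∀ n : ℕ, 1 / ((n : ℝ) + 1) > 0 := fun n => by positivity
  refine ⟨fun n => ν (1 / ((n : ℝ) + 1)) (hp n), fun n => hν _ (hp n), tendsto_of_weakDist hΨ ?_⟩
  exact squeeze_zero (fun _ => weakDist_nonneg Ψ _ _) (fun n => (hd _ (hp n)).le)
    tendsto_one_div_add_atTop_nhds_zero_nat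

/-! ### Invariance of pseudo-physical measures -/

theorem mem_invariantMeasures_of_integral {f : Maps} {μ : Measures}
    (h : ∀ g : C(unitInterval, ℝ), ∫ x, g (f x) ∂(μ : Measure unitInterval) =
      ∫ x, g x ∂(μ : Measure unitInterval)) : μ ∈ invariantMeasures f := by
  refine ⟨f.continuous.measurable, ?_⟩
  have : μ.map f.continuous.measurable.aemeasurable = μ := by
    refine measures_ext fun g => ?_
    rw [ProbabilityMeasure.toMeasure_map, integral_map f.continuous.measurable.aemeasurable
      g.continuous.aestronglyMeasurable, h g]
  conv_rhs => rw [← this]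
  rfl

theorem integral_comp_of_mem {f : Maps} {μ : Measures} (hμ : μ ∈ invariantMeasures f)
    (g : C(unitInterval, ℝ)) : ∫ x, g (f x) ∂(μ : Measure unitInterval) =
      ∫ x, g x ∂(μ : Measure unitInterval) := by
  have hm : MeasurePreserving f (μ : Measure unitInterval) (μ : Measure unitInterval) := hμ
  conv_rhs => rw [← hm.map_eq]
  rw [integral_map hm.measurable.aemeasurable g.continuous.aestronglyMeasurable]

theorem isClosed_invariantMeasures (f : Maps) : IsClosed (invariantMeasures f) := by
  have : invariantMeasures f = ⋂ g : C(unitInterval, ℝ),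
      {μ : Measures | ∫ x, g (f x) ∂(μ : Measure unitInterval) =
        ∫ x, g x ∂(μ : Measure unitInterval)} := by
    ext μ
    simp only [mem_iInter, mem_ofPred_eq]
    exact ⟨fun h g => integral_comp_of_mem h g, mem_invariantMeasures_of_integral⟩
  rw [this]
  exact isClosed_iInter fun g => isClosed_eq
    (continuous_integral_measures (g.continuous.comp f.continuous))
    (continuous_integral_measures g.continuous)

/-- The averages of `g ∘ f` and of `g` along an orbit segment differ by a telescoping sum, at most
`2‖g‖` divided by the length. -/
theorem limitMeasures_subset (f : Maps) (x : unitInterval) :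
    limitMeasures f x ⊆ invariantMeasures f := by
  rintro ν ⟨φ, hφ, hν⟩
  refine mem_invariantMeasures_of_integral fun g => ?_
  have h1 := ((continuous_integral_measures (g.continuous.comp f.continuous)).tendsto ν).comp hν
  have h2 := ((continuous_integral_measures g.continuous).tendsto ν).comp hν
  refine sub_eq_zero.1 (tendsto_nhds_unique (h1.sub h2) ?_)
  have hb : ∀ k, ‖((fun μ : Measures => ∫ y, (g ∘ f) y ∂(μ : Measure unitInterval)) ∘
      fun k => empirical f x (φ k)) k -
      ((fun μ : Measures => ∫ y, g y ∂(μ : Measure unitInterval)) ∘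
      fun k => empirical f x (φ k)) k‖ ≤ (1 / ((k : ℝ) + 1)) * (2 * ‖g‖) := by
    intro k
    simp only [Function.comp_def, integral_empirical]
    rw [← mul_sub, ← Finset.sum_sub_distrib, norm_mul]
    have hs : ∑ j ∈ Finset.range (φ k + 1), (g (f (f^[j] x)) - g (f^[j] x)) =
        g (f^[φ k + 1] x) - g x := by
      simp_rw [← Function.iterate_succ_apply' f]
      exact Finset.sum_range_sub (fun j => g (f^[j] x)) (φ k + 1)
    rw [hs]
    refine mul_le_mul ?_ ?_ (norm_nonneg _) (by positivity)
    · rw [norm_inv, Real.norm_of_nonneg (by positivity), one_div]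
      have : (k : ℝ) ≤ φ k := by exact_mod_cast hφ.le_apply
      gcongr
    · calc ‖g (f^[φ k + 1] x) - g x‖ ≤ ‖g (f^[φ k + 1] x)‖ + ‖g x‖ := norm_sub_le _ _
        _ ≤ 2 * ‖g‖ := by linarith [g.norm_coe_le_norm (f^[φ k + 1] x), g.norm_coe_le_norm x]
  refine squeeze_zero_norm hb ?_
  simpa using (tendsto_one_div_add_atTop_nhds_zero_nat (𝕜 := ℝ)).mul_const (2 * ‖g‖)

/-- Basins of positive volume are nonempty, so `μ` is a limit of invariant measures, and these form
a closed set. -/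
theorem pseudoPhysical_subset (hΨ : DenseRange Ψ) (f : Maps) :
    pseudoPhysical Ψ f ⊆ invariantMeasures f := by
  intro μ hμ
  obtain ⟨ν, hν, hlim⟩ := exists_seq_tendsto_of_weakDist hΨ (S := invariantMeasures f) (μ := μ)
    fun ε hε => by
      obtain ⟨x, hx⟩ := nonempty_of_measure_ne_zero (hμ ε hε).ne'
      obtain ⟨ν, hν, hd⟩ := hx
      exact ⟨ν, limitMeasures_subset f x hν, hd⟩
  exact (isClosed_invariantMeasures f).mem_of_tendsto hlim (Eventually.of_forall hν)

end IntervalMaps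

namespace IntervalMaps

/-! ### Typical maps -/

theorem isTypical_of_forall_mem_closure {ι : Type*} [Countable ι] (A : ι → Set Maps)
    (hA : ∀ i, IsOpen (A i)) : IsTypical fun f => ∀ i, f ∈ closure (A i) → f ∈ A i := by
  have ho : ∀ i, IsOpen (A i ∪ (closure (A i))ᶜ) := fun i =>
    (hA i).union isClosed_closure.isOpen_compl
  refine ⟨⋂ i, (A i ∪ (closure (A i))ᶜ), IsGδ.iInter_of_isOpen ho,
    dense_iInter_of_isOpen ho fun i => ?_, fun f hf i hi => ?_⟩
  · intro f
    by_cases hf : f ∈ closure (A i)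
    · exact closure_mono subset_union_left hf
    · exact subset_closure (Or.inr hf)
  · exact (mem_iInter.1 hf i).resolve_right fun h => h hi

/-! ### Perturbations -/

/-- Tietze extension, preserving the norm, of the prescribed change `t - f` on the finite set; the
projection back to `[0,1]` is 1-Lipschitz and so does not enlarge the perturbation. -/
theorem exists_dist_le_of_finite (f : Maps) {S : Set unitInterval} (hS : S.Finite)
    (t : unitInterval → unitInterval) {δ : ℝ} (hδ : 0 ≤ δ) (h : ∀ p ∈ S, dist (t p) (f p) ≤ δ) :
    ∃ g : Maps, dist g f ≤ δ ∧ ∀ p ∈ S, g p = t p := by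
  have : Finite S := hS
  let d : BoundedContinuousFunction S ℝ := BoundedContinuousFunction.mkOfCompact
    ⟨fun p => (t p : ℝ) - (f p : ℝ), continuous_of_discreteTopology⟩
  have hd : ‖d‖ ≤ δ := (BoundedContinuousFunction.norm_le hδ).2 fun p => h p p.2
  obtain ⟨D, hD, hDS⟩ :=
    BoundedContinuousFunction.exists_norm_eq_domRestrict_eq_of_closed d hS.isClosed
  refine ⟨⟨fun x => projIcc 0 1 zero_le_one ((f x : ℝ) + D x), by fun_prop⟩, ?_, fun p hp => ?_⟩
  · rw [ContinuousMap.dist_le hδ]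
    intro x
    have h1 : f x = projIcc (0 : ℝ) 1 zero_le_one (f x : ℝ) := (projIcc_val _ _).symm
    calc dist (projIcc (0 : ℝ) 1 zero_le_one ((f x : ℝ) + D x)) (f x)
        = dist (projIcc (0 : ℝ) 1 zero_le_one ((f x : ℝ) + D x))
            (projIcc (0 : ℝ) 1 zero_le_one (f x : ℝ)) := by rw [← h1]
      _ ≤ dist ((f x : ℝ) + D x) (f x : ℝ) := by
          simpa using (LipschitzWith.projIcc (zero_le_one' ℝ)).dist_le_mul
            ((f x : ℝ) + D x) (f x : ℝ)
      _ = ‖D x‖ := by simp [dist_eq_norm]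
      _ ≤ δ := (D.norm_coe_le_norm x).trans (hD.le.trans hd)
  · have h2 : D p = (t p : ℝ) - (f p : ℝ) := DFunLike.congr_fun hDS ⟨p, hp⟩
    change projIcc (0 : ℝ) 1 zero_le_one ((f p : ℝ) + D p) = t p
    rw [h2, add_sub_cancel, projIcc_val]

/-- Interpolate between `f` and the constant `f x₀` with a cutoff `u` equal to `1` on the `η`-ball
and `0` outside the `2η`-ball; convex combinations stay in `[0,1]`. -/
theorem exists_constant_near (f : Maps) (x₀ : unitInterval) {η δ : ℝ} (hη : 0 < η) (hδ : 0 ≤ δ)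
    (h : ∀ y, dist y x₀ ≤ 2 * η → dist (f x₀) (f y) ≤ δ) :
    ∃ g : Maps, dist g f ≤ δ ∧ (∀ y, dist y x₀ ≤ η → g y = f x₀) ∧
      ∀ y, 2 * η ≤ dist y x₀ → g y = f y := by
  let u : unitInterval → ℝ := fun y => max 0 (min 1 (2 - dist y x₀ / η))
  have hu0 : ∀ y, 0 ≤ u y := fun y => le_max_left _ _
  have hu1 : ∀ y, u y ≤ 1 := fun y => max_le zero_le_one (min_le_left _ _)
  have huc : Continuous u := by fun_prop
  have hmem : ∀ y, (f y : ℝ) + u y * ((f x₀ : ℝ) - f y) ∈ unitInterval := by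
    intro y
    have h1 := (f y).2
    have h2 := (f x₀).2
    have h3 := hu0 y
    have h4 := hu1 y
    constructor
    · nlinarith [mul_nonneg h3 h2.1, mul_nonneg (sub_nonneg.2 h4) h1.1]
    · nlinarith [mul_nonneg h3 (sub_nonneg.2 h2.2),
        mul_nonneg (sub_nonneg.2 h4) (sub_nonneg.2 h1.2)]
  refine ⟨⟨fun y => ⟨(f y : ℝ) + u y * ((f x₀ : ℝ) - f y), hmem y⟩, by fun_prop⟩, ?_, ?_, ?_⟩
  · rw [ContinuousMap.dist_le hδ]
    intro y
    rw [Subtype.dist_eq, Real.dist_eq]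
    change |(f y : ℝ) + u y * ((f x₀ : ℝ) - f y) - f y| ≤ δ
    rw [add_sub_cancel_left, abs_mul, abs_of_nonneg (hu0 y)]
    by_cases hy : dist y x₀ ≤ 2 * η
    · have := h y hy
      rw [Subtype.dist_eq, Real.dist_eq] at this
      exact (mul_le_of_le_one_left (abs_nonneg _) (hu1 y)).trans this
    · have : u y = 0 := by
        apply max_eq_left
        refine (min_le_right _ _).trans ?_
        rw [sub_nonpos, le_div_iff₀ hη]
        exact (not_le.1 hy).le
      rw [this, zero_mul]; exact hδ
  · intro y hy
    have : u y = 1 := by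
      have h1 : 1 ≤ 2 - dist y x₀ / η := by
        have := (div_le_one hη).2 hy
        linarith
      simp [u, min_eq_left h1]
    apply Subtype.ext
    change (f y : ℝ) + u y * ((f x₀ : ℝ) - f y) = f x₀
    rw [this]; ring
  · intro y hy
    have : u y = 0 := by
      apply max_eq_left
      refine (min_le_right _ _).trans ?_
      rwa [sub_nonpos, le_div_iff₀ hη]
    apply Subtype.ext
    change (f y : ℝ) + u y * ((f x₀ : ℝ) - f y) = f y
    rw [this]; ring

/-! ### Attracting balls -/

variable (Ψ : ℕ → Maps)

/-- The maps with a ball that an iterate maps well into itself, along which the empirical measures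
are close to `ν`. -/
def attracting (ν : Measures) (r : ℝ) : Set Maps :=
  {f | ∃ (x₀ : unitInterval) (η : ℝ) (p : ℕ), 0 < η ∧
    (∀ y ∈ Metric.closedBall x₀ η, f^[p + 1] y ∈ Metric.ball x₀ η) ∧
    ∀ y ∈ Metric.closedBall x₀ η, weakDist Ψ (empirical f y p) ν < r}

theorem continuous_iterate_apply (j : ℕ) :
    Continuous fun q : Maps × unitInterval => q.1^[j] q.2 := by
  induction j with
  | zero => exact continuous_snd
  | succ j ih =>
    simp_rw [Function.iterate_succ_apply']
    exact continuous_fst.eval ih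

theorem continuous_weakDist_empirical (ν : Measures) (p : ℕ) :
    Continuous fun q : Maps × unitInterval => weakDist Ψ (empirical q.1 q.2 p) ν := by
  refine continuous_weakDist_of_continuous Ψ _ ν fun i => ?_
  simp_rw [integral_empirical]
  refine continuous_const.mul (continuous_finsetSum _ fun j _ => ?_)
  exact continuous_subtype_val.comp ((Ψ i).continuous.comp (continuous_iterate_apply j))

/-- The tube lemma. It makes `attracting` open, because the conditions there are strict and range
over a compact ball. -/
theorem isOpen_forall_of_isCompact {K : Set unitInterval} (hK : IsCompact K)
    {U : Set (Maps × unitInterval)} (hU : IsOpen U) : IsOpen {f : Maps | ∀ y ∈ K, (f, y) ∈ U} := by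
  rw [isOpen_iff_mem_nhds]
  intro f hf
  exact hK.eventually_forall_of_forall_eventually fun y hy => hU.mem_nhds (hf y hy)

theorem isOpen_attracting (ν : Measures) (r : ℝ) : IsOpen (attracting Ψ ν r) := by
  have : attracting Ψ ν r = ⋃ (x₀ : unitInterval) (η : ℝ) (p : ℕ) (_ : 0 < η),
      ({f | ∀ y ∈ Metric.closedBall x₀ η,
        (f, y) ∈ {q : Maps × unitInterval | q.1^[p + 1] q.2 ∈ Metric.ball x₀ η}} ∩
      {f | ∀ y ∈ Metric.closedBall x₀ η,
        (f, y) ∈ {q : Maps × unitInterval | weakDist Ψ (empirical q.1 q.2 p) ν < r}}) := by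
    ext f
    simp only [attracting, mem_ofPred_eq, mem_iUnion, mem_inter_iff, exists_prop]
  rw [this]
  refine isOpen_iUnion fun x₀ => isOpen_iUnion fun η => isOpen_iUnion fun p =>
    isOpen_iUnion fun _ => ?_
  exact (isOpen_forall_of_isCompact (isCompact_closedBall _ _)
      (Metric.isOpen_ball.preimage (continuous_iterate_apply (p + 1)))).inter
    (isOpen_forall_of_isCompact (isCompact_closedBall _ _)
      (isOpen_lt (continuous_weakDist_empirical Ψ ν p) continuous_const))

/-- Only the terms at time `0` differ, and they carry weight `1 / (p + 1) ≤ 1`. -/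
theorem weakDist_empirical_le {f g : Maps} {x y : unitInterval} {p : ℕ}
    (h : ∀ i, 0 < i → i ≤ p → f^[i] x = g^[i] y) :
    weakDist Ψ (empirical f x p) (empirical g y p) ≤
      weakDist Ψ (diracProba x) (diracProba y) := by
  refine (summable_weakDist Ψ _ _).tsum_le_tsum (fun i => ?_) (summable_weakDist Ψ _ _)
  refine mul_le_mul_of_nonneg_left ?_ (by positivity)
  rw [integral_empirical f x p fun y => (Ψ i y : ℝ), integral_empirical g y p fun y => (Ψ i y : ℝ)]
  rw [← mul_sub, ← Finset.sum_sub_distrib, Finset.sum_range_succ', Finset.sum_eq_zero, zero_add,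
    abs_mul]
  · simp only [Function.iterate_zero, id_eq, diracProba]
    simp only [ProbabilityMeasure.coe_mk, integral_dirac]
    refine mul_le_of_le_one_left (abs_nonneg _) ?_
    rw [abs_of_nonneg (by positivity)]
    exact inv_le_one_of_one_le₀ (by linarith [(Nat.cast_nonneg p : (0 : ℝ) ≤ p)])
  · intro j hj
    rw [h (j + 1) (Nat.succ_pos j) (Finset.mem_range.1 hj), sub_self]

/-- A closing lemma in two perturbations. The first, of size `δ'`, sends the last point of the
segment back to `x`; injectivity keeps the other points of the segment unaffected. The second, of
size `δ - δ'`, makes the map constant near `x`, so that a whole ball follows the closed orbit and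
lands on `x` itself. -/
theorem exists_mem_attracting (f : Maps) (x : unitInterval) (p : ℕ) {ν : Measures} {r δ δ' : ℝ}
    (hinj : ∀ i ≤ p, ∀ j ≤ p, f^[i] x = f^[j] x → i = j) (hδ' : 0 ≤ δ')
    (hret : dist x (f^[p + 1] x) ≤ δ') (hδ : δ' < δ) (hd : weakDist Ψ (empirical f x p) ν < r) :
    ∃ g ∈ attracting Ψ ν r, dist g f ≤ δ := by
  classical
  obtain ⟨g, hgf, hg⟩ := exists_dist_le_of_finite f
    ((Finset.range (p + 1)).image fun i => f^[i] x).finite_toSet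
    (fun y => if y = f^[p] x then x else f y) hδ' (by
      intro y _
      split_ifs with hy
      · rwa [hy, ← Function.iterate_succ_apply' (⇑f)]
      · simpa using hδ')
  have hg1 : ∀ i < p, g (f^[i] x) = f^[i + 1] x := by
    intro i hi
    rw [hg _ (by simpa using ⟨i, by omega, rfl⟩), if_neg, Function.iterate_succ_apply']
    exact fun h => hi.ne (hinj _ hi.le _ le_rfl h)
  have hgp : g (f^[p] x) = x := by
    rw [hg _ (by simpa using ⟨p, by omega, rfl⟩), if_pos rfl]
  have hgi : ∀ i ≤ p, g^[i] x = f^[i] x := by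
    intro i
    induction i with
    | zero => simp
    | succ i ih => intro hi; rw [Function.iterate_succ_apply', ih (by omega), hg1 i (by omega)]
  -- The flattening must leave the rest of the orbit alone: the later points have to lie outside the
  -- `2η`-ball around `x`.
  have hdist : ∀ᶠ η in 𝓝 (0 : ℝ), ∀ i ∈ Finset.range p, 2 * η < dist (f^[i + 1] x) x := by
    rw [Finset.eventually_all]
    intro i hi
    have hpos : 2 * 0 < dist (f^[i + 1] x) x := by
      rw [mul_zero, dist_pos]
      intro h
      have := hinj (i + 1) (by have := Finset.mem_range.1 hi; omega) 0 (by omega) h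
      omega
    exact ((continuous_const.mul continuous_id).tendsto (0 : ℝ)).eventually_lt_const hpos
  obtain ⟨ε₁, hε₁, h₁⟩ := Metric.eventually_nhds_iff.1 hdist
  obtain ⟨ε₂, hε₂, h₂⟩ := Metric.eventually_nhds_iff.1
    ((g.continuous.tendsto x).eventually (Metric.closedBall_mem_nhds (g x) (sub_pos.2 hδ)))
  have h₃' : ∀ᶠ y in 𝓝 x, weakDist Ψ (diracProba y) (diracProba x) <
      r - weakDist Ψ (empirical f x p) ν := by
    have hc : Continuous fun y => weakDist Ψ (diracProba y) (diracProba x) :=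
      (continuous_weakDist Ψ _).comp continuous_diracProba
    refine (hc.tendsto x).eventually_lt_const ?_
    rw [weakDist_self]; linarith
  obtain ⟨ε₃, hε₃, h₃⟩ := Metric.eventually_nhds_iff.1 h₃'
  -- One third of the least radius, so that even `2 * η` is below `ε₂`, as the continuity estimate
  -- for the flattening requires.
  set η := min ε₁ (min ε₂ ε₃) / 3 with hη
  have hm : 0 < min ε₁ (min ε₂ ε₃) := by positivity
  have hη0 : 0 < η := by positivity
  have hη1 : η < ε₁ := by have := min_le_left ε₁ (min ε₂ ε₃); linarith
  have hη2 : 2 * η < ε₂ := by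
    have := (min_le_right ε₁ (min ε₂ ε₃)).trans (min_le_left _ _); linarith
  have hη3 : η < ε₃ := by
    have := (min_le_right ε₁ (min ε₂ ε₃)).trans (min_le_right _ _); linarith
  obtain ⟨k, hkg, hk1, hk2⟩ := exists_constant_near g x hη0 (sub_pos.2 hδ).le fun y hy => by
    rw [dist_comm]; exact h₂ (hy.trans_lt hη2)
  have hki : ∀ y, dist y x ≤ η → ∀ i < p + 1, k^[i + 1] y = g^[i + 1] x := by
    intro y hy i
    induction i with
    | zero => intro _; simpa using hk1 y hy
    | succ i ih =>
      intro hi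
      rw [Function.iterate_succ_apply' k, ih (by omega), Function.iterate_succ_apply' g (i + 1)]
      refine hk2 _ ?_
      rw [hgi _ (by omega)]
      refine (h₁ (y := η) ?_ i (Finset.mem_range.2 (by omega))).le
      rwa [Real.dist_eq, sub_zero, abs_of_pos hη0]
  refine ⟨k, ⟨x, η, p, hη0, fun y hy => ?_, fun y hy => ?_⟩, ?_⟩
  · rw [hki y hy p (by omega), Function.iterate_succ_apply', hgi p le_rfl, hgp]
    exact Metric.mem_ball_self hη0
  · have := weakDist_empirical_le Ψ (f := k) (g := f) (x := y) (y := x) (p := p) fun i hi hip => by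
      obtain ⟨i, rfl⟩ := Nat.exists_eq_succ_of_ne_zero hi.ne'
      rw [hki y hy i (by omega), hgi _ hip]
    have h4 := h₃ (lt_of_le_of_lt hy hη3)
    linarith [weakDist_triangle Ψ (empirical k y p) (empirical f x p) ν]
  · linarith [dist_triangle k g f]

theorem mem_closure_attracting {f : Maps} {ν : Measures} {r : ℝ}
    (h : ∀ δ > 0, ∃ (x : unitInterval) (p : ℕ),
      (∀ i ≤ p, ∀ j ≤ p, f^[i] x = f^[j] x → i = j) ∧ dist x (f^[p + 1] x) ≤ δ ∧
      weakDist Ψ (empirical f x p) ν < r) : f ∈ closure (attracting Ψ ν r) := by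
  refine Metric.mem_closure_iff.2 fun ε hε => ?_
  obtain ⟨x, p, hinj, hret, hd⟩ := h (ε / 4) (by positivity)
  obtain ⟨g, hg, hgf⟩ := exists_mem_attracting Ψ f x p hinj (by positivity) hret
    (show ε / 4 < ε / 2 by linarith) hd
  exact ⟨g, hg, by rw [dist_comm]; linarith⟩

end IntervalMaps

namespace IntervalMaps

/-! ### Measures of maps with attracting balls -/

theorem sum_range_mul_block (f : Maps) (x : unitInterval) (g : unitInterval → ℝ) (p q : ℕ) :
    ∑ j ∈ Finset.range (p * q), g (f^[j] x) =
      ∑ i ∈ Finset.range q, ∑ j ∈ Finset.range p, g (f^[j] (f^[p * i] x)) := by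
  induction q with
  | zero => simp
  | succ q ih =>
    rw [Nat.mul_succ, Finset.sum_range_add, ih, Finset.sum_range_succ]
    congr 1
    refine Finset.sum_congr rfl fun j _ => ?_
    rw [add_comm, Function.iterate_add_apply]

/-- The first `(p + 1) * (q + 1)` orbit points split into `q + 1` blocks of length `p + 1`; the
index is one less than the number of points. -/
theorem integral_empirical_block (f : Maps) (x : unitInterval) (g : unitInterval → ℝ) (p q : ℕ) :
    ∫ y, g y ∂(empirical f x ((p + 1) * q + p) : Measure unitInterval) =
      (q + 1 : ℝ)⁻¹ * ∑ i ∈ Finset.range (q + 1),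
        ∫ y, g y ∂(empirical f (f^[(p + 1) * i] x) p : Measure unitInterval) := by
  simp_rw [integral_empirical]
  rw [show (p + 1) * q + p + 1 = (p + 1) * (q + 1) by ring, sum_range_mul_block, ← Finset.mul_sum,
    ← mul_assoc]
  congr 1
  push_cast
  rw [← mul_inv]
  congr 1
  ring

variable (Ψ : ℕ → Maps)

/-- Convexity of `weakDist` in its first argument; that `E` is the average of the `e j` is needed
only for the integrals of the `Ψ i`. -/
theorem weakDist_average_le {ν E : Measures} {e : ℕ → Measures} {q : ℕ} {r : ℝ}
    (hE : ∀ i, ∫ y, (Ψ i y : ℝ) ∂(E : Measure unitInterval) = (q + 1 : ℝ)⁻¹ *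
      ∑ j ∈ Finset.range (q + 1), ∫ y, (Ψ i y : ℝ) ∂(e j : Measure unitInterval))
    (he : ∀ j, weakDist Ψ (e j) ν ≤ r) : weakDist Ψ E ν ≤ r := by
  have hq : (0 : ℝ) < q + 1 := by positivity
  let t : ℕ → ℕ → ℝ := fun j i => (1 / 2 : ℝ) ^ (i + 1) *
      |(∫ y, (Ψ i y : ℝ) ∂(e j : Measure unitInterval)) -
        ∫ y, (Ψ i y : ℝ) ∂(ν : Measure unitInterval)|
  have hs : ∀ j ∈ Finset.range (q + 1), Summable (t j) := fun j _ => summable_weakDist Ψ (e j) ν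
  calc weakDist Ψ E ν ≤ ∑' i, (q + 1 : ℝ)⁻¹ * ∑ j ∈ Finset.range (q + 1), t j i := by
        refine (summable_weakDist Ψ E ν).tsum_le_tsum (fun i => ?_)
          ((summable_sum hs).mul_left _)
        have h1 : ∫ y, (Ψ i y : ℝ) ∂(ν : Measure unitInterval) = (q + 1 : ℝ)⁻¹ *
            ∑ j ∈ Finset.range (q + 1), ∫ y, (Ψ i y : ℝ) ∂(ν : Measure unitInterval) := by
          simp only [Finset.sum_const, Finset.card_range, nsmul_eq_mul]
          push_cast
          field_simp
        rw [hE, h1, ← mul_sub, ← Finset.sum_sub_distrib, abs_mul, abs_of_pos (inv_pos.2 hq),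
          mul_left_comm]
        simp only [t]
        rw [← Finset.mul_sum]
        gcongr
        exact Finset.abs_sum_le_sum_abs _ _
    _ = (q + 1 : ℝ)⁻¹ * ∑ j ∈ Finset.range (q + 1), weakDist Ψ (e j) ν := by
        rw [tsum_mul_left, Summable.tsum_finsetSum hs]
        rfl
    _ ≤ (q + 1 : ℝ)⁻¹ * ∑ j ∈ Finset.range (q + 1), r := by
        gcongr with j _
        exact he j
    _ = r := by
        simp only [Finset.sum_const, Finset.card_range, nsmul_eq_mul]
        push_cast
        field_simp

theorem volume_ball_pos (x : unitInterval) {η : ℝ} (hη : 0 < η) :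
    0 < volume (Metric.closedBall x η) := by
  rw [unitInterval.volume_apply]
  have hsub : Icc (max 0 ((x : ℝ) - η)) (min 1 ((x : ℝ) + η)) ⊆
      (Subtype.val : unitInterval → ℝ) '' Metric.closedBall x η := by
    intro y hy
    have h1 := max_le_iff.1 hy.1
    have h2 := le_min_iff.1 hy.2
    refine ⟨⟨y, h1.1, h2.1⟩, ?_, rfl⟩
    rw [Metric.mem_closedBall, Subtype.dist_eq, Real.dist_eq, abs_le]
    constructor <;> simp only <;> linarith [h1.2, h2.2]
  refine lt_of_lt_of_le ?_ (measure_mono hsub)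
  rw [Real.volume_Icc, ENNReal.ofReal_pos, sub_pos, max_lt_iff, lt_min_iff, lt_min_iff]
  have := x.2.1
  have := x.2.2
  refine ⟨⟨one_pos, ?_⟩, ?_, ?_⟩ <;> linarith

variable {Ψ}

/-- The entire ball lies in the basin: each orbit starting there returns to it every `p + 1` steps,
so the empirical measures over whole blocks stay within `r` of `ν`, and compactness gives a limit
measure at distance at most `r < r'`. -/
theorem volume_basin_pos {f : Maps} {ν : Measures} {r r' : ℝ} (hf : f ∈ attracting Ψ ν r)
    (hr : r < r') : 0 < volume (basin Ψ f ν r') := by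
  obtain ⟨x₀, η, p, hη, hmaps, hd⟩ := hf
  refine (volume_ball_pos x₀ hη).trans_le (measure_mono fun y hy => ?_)
  have hiter : ∀ i, f^[(p + 1) * i] y ∈ Metric.closedBall x₀ η := by
    intro i
    induction i with
    | zero => simpa using hy
    | succ i ih =>
      rw [Nat.mul_succ, add_comm, Function.iterate_add_apply]
      exact Metric.ball_subset_closedBall (hmaps _ ih)
  have hE : ∀ q, weakDist Ψ (empirical f y ((p + 1) * q + p)) ν ≤ r := fun q =>
    weakDist_average_le Ψ (e := fun i => empirical f (f^[(p + 1) * i] y) p)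
      (fun i => integral_empirical_block f y (fun z => (Ψ i z : ℝ)) p q)
      fun j => (hd _ (hiter j)).le
  obtain ⟨ρ, φ, hφ, hρ⟩ := CompactSpace.tendsto_subseq
    fun q => empirical f y ((p + 1) * q + p)
  refine ⟨ρ, ⟨fun k => (p + 1) * φ k + p, fun a b hab => ?_, hρ⟩, ?_⟩
  · have := hφ hab
    have := Nat.mul_lt_mul_of_pos_left this (Nat.succ_pos p)
    simp only [Nat.succ_eq_add_one] at this ⊢
    omega
  · refine lt_of_le_of_lt ?_ hr
    exact le_of_tendsto (((continuous_weakDist Ψ ν).tendsto ρ).comp hρ)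
      (Eventually.of_forall fun k => hE (φ k))

/-- `p + 1` may be a proper multiple of the minimal period; averaging over several turns of the
orbit gives the same measure. -/
theorem empirical_mem_periodicMeasures {f : Maps} {x : unitInterval} {p : ℕ}
    (hx : f^[p + 1] x = x) : empirical f x p ∈ periodicMeasures f := by
  have hper : Function.IsPeriodicPt f (p + 1) x := hx
  have hpos := hper.minimalPeriod_pos (Nat.succ_pos p)
  obtain ⟨k, hk⟩ := hper.minimalPeriod_dvd
  obtain ⟨q, hq⟩ := Nat.exists_eq_succ_of_ne_zero hpos.ne'
  rw [hq] at hk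
  obtain ⟨k, rfl⟩ : ∃ l, k = l + 1 := Nat.exists_eq_succ_of_ne_zero (by rintro rfl; omega)
  obtain rfl : p = (q + 1) * k + q := by
    rw [Nat.mul_succ] at hk; simp only [Nat.succ_eq_add_one] at hk; omega
  refine ⟨x, q, hq, measures_ext fun g => ?_⟩
  have hq' : Function.IsPeriodicPt f (q + 1) x := by
    have := Function.isPeriodicPt_minimalPeriod f x
    rwa [hq] at this
  have hfix : ∀ i, f^[(q + 1) * i] x = x := fun i => hq'.mul_const i
  rw [integral_empirical_block]
  simp only [hfix, Finset.sum_const, Finset.card_range, nsmul_eq_mul]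
  push_cast
  field_simp

theorem exists_periodic_of_mem_attracting {f : Maps} {ν : Measures} {r : ℝ}
    (hf : f ∈ attracting Ψ ν r) : ∃ μ ∈ periodicMeasures f, weakDist Ψ μ ν < r := by
  obtain ⟨x₀, η, p, hη, hmaps, hd⟩ := hf
  have hball : Metric.closedBall x₀ η =
      -- A closed ball of `[0,1]` is an interval with clamped endpoints, so the intermediate value
      -- theorem gives the return map a fixed point in it.
      Icc (projIcc 0 1 zero_le_one ((x₀ : ℝ) - η) : unitInterval)
        (projIcc 0 1 zero_le_one ((x₀ : ℝ) + η)) := by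
    ext y
    have := y.2.1
    have := y.2.2
    have := x₀.2.1
    have := x₀.2.2
    rw [Metric.mem_closedBall, Subtype.dist_eq, Real.dist_eq, abs_le, mem_Icc,
      ← Subtype.coe_le_coe, ← Subtype.coe_le_coe, coe_projIcc, coe_projIcc]
    rw [max_le_iff, min_le_iff, le_max_iff, le_min_iff]
    constructor
    · rintro ⟨h1, h2⟩
      exact ⟨⟨y.2.1, Or.inr (by linarith)⟩, Or.inr ⟨y.2.2, by linarith⟩⟩
    · rintro ⟨⟨_, h1⟩, h2⟩
      constructor
      · rcases h1 with h1 | h1 <;> linarith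
      · rcases h2 with h2 | h2 <;> linarith [h2]
  obtain ⟨x, hx, hfix⟩ := exists_mem_Icc_isFixedPt_of_mapsTo
    (f := f^[p + 1]) (a := (projIcc 0 1 zero_le_one ((x₀ : ℝ) - η) : unitInterval))
    (b := projIcc 0 1 zero_le_one ((x₀ : ℝ) + η)) (f.continuous.iterate _).continuousOn
    (monotone_projIcc _ (by linarith)) (by
      rw [← hball]
      exact fun y hy => Metric.ball_subset_closedBall (hmaps y hy))
  rw [← hball] at hx
  exact ⟨_, empirical_mem_periodicMeasures hfix, hd x hx⟩

instance : Nonempty Measures := ⟨diracProba 0⟩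

variable (Ψ) in
/-- Attracting balls that can be created by arbitrarily small perturbations of `f` are already
there. -/
def HasAttractors (f : Maps) : Prop :=
  ∀ j k : ℕ, f ∈ closure (attracting Ψ (TopologicalSpace.denseSeq Measures j)
    (1 / ((k : ℝ) + 1))) → f ∈ attracting Ψ (TopologicalSpace.denseSeq Measures j)
    (1 / ((k : ℝ) + 1))

variable (Ψ) in
/-- `μ` is approximated by the empirical measures of nearly closed orbit segments. -/
def IsClosable (f : Maps) (μ : Measures) : Prop :=
  ∀ δ > 0, ∃ (x : unitInterval) (p : ℕ),
    (∀ i ≤ p, ∀ j ≤ p, f^[i] x = f^[j] x → i = j) ∧ dist x (f^[p + 1] x) ≤ δ ∧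
    weakDist Ψ (empirical f x p) μ < δ

theorem exists_denseSeq_weakDist_lt (μ : Measures) {ε : ℝ} (hε : 0 < ε) :
    ∃ j, weakDist Ψ μ (TopologicalSpace.denseSeq Measures j) < ε := by
  have ho : IsOpen {ν | weakDist Ψ ν μ < ε} := isOpen_lt (continuous_weakDist Ψ μ) continuous_const
  obtain ⟨j, hν⟩ := (TopologicalSpace.denseRange_denseSeq Measures).exists_mem_open ho
    ⟨μ, by simpa [weakDist_self] using hε⟩
  exact ⟨j, by rw [weakDist_comm]; exact hν⟩

/-- `HasAttractors` covers only countably many centres and radii, so `μ` is replaced by a nearby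
member of the dense sequence, at the cost of half the radius. -/
theorem mem_attracting_of_closable {f : Maps}
    (hf : HasAttractors Ψ f) {μ : Measures} (hμ : IsClosable Ψ f μ) {ε : ℝ} (hε : 0 < ε) :
    ∃ ν r, r < ε ∧ weakDist Ψ μ ν < ε ∧ f ∈ attracting Ψ ν r := by
  obtain ⟨k, hk⟩ := exists_nat_one_div_lt hε
  have hk0 : (0 : ℝ) < 1 / ((k : ℝ) + 1) := by positivity
  obtain ⟨j, hj⟩ := exists_denseSeq_weakDist_lt (Ψ := Ψ) μ (half_pos hk0)
  refine ⟨_, _, hk, by linarith, hf j k (mem_closure_attracting Ψ fun δ hδ => ?_)⟩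
  obtain ⟨x, p, h1, h2, h3⟩ := hμ (min δ (1 / ((k : ℝ) + 1) / 2)) (by positivity)
  refine ⟨x, p, h1, h2.trans (min_le_left _ _), ?_⟩
  have := h3.trans_le (min_le_right _ _)
  linarith [weakDist_triangle Ψ (empirical f x p) μ (TopologicalSpace.denseSeq Measures j)]

theorem mem_pseudoPhysical_of_closable {f : Maps}
    (hf : HasAttractors Ψ f) {μ : Measures} (hμ : IsClosable Ψ f μ) : μ ∈ pseudoPhysical Ψ f := by
  intro ε hε
  obtain ⟨ν, r, hr, hd, ha⟩ := mem_attracting_of_closable hf hμ (half_pos hε)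
  refine (volume_basin_pos ha hr).trans_le (measure_mono ?_)
  rintro x ⟨ρ, hρ, hρd⟩
  refine ⟨ρ, hρ, (weakDist_triangle Ψ ρ ν μ).trans_lt ?_⟩
  rw [weakDist_comm Ψ ν μ]
  linarith

theorem exists_periodic_of_closable {f : Maps}
    (hf : HasAttractors Ψ f) {μ : Measures} (hμ : IsClosable Ψ f μ) {ε : ℝ} (hε : 0 < ε) :
    ∃ ν ∈ periodicMeasures f, weakDist Ψ ν μ < ε := by
  obtain ⟨ν, r, hr, hd, ha⟩ := mem_attracting_of_closable hf hμ (half_pos hε)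
  obtain ⟨ρ, hρ, hρd⟩ := exists_periodic_of_mem_attracting ha
  refine ⟨ρ, hρ, (weakDist_triangle Ψ ρ ν μ).trans_lt ?_⟩
  rw [weakDist_comm Ψ ν μ]
  linarith

theorem closable_of_periodic {f : Maps} {μ : Measures} (hμ : μ ∈ periodicMeasures f) :
    IsClosable Ψ f μ := by
  intro δ hδ
  obtain ⟨x, n, hn, rfl⟩ := hμ
  refine ⟨x, n, fun i hi j hj h => ?_, ?_, by rwa [weakDist_self]⟩
  · refine Function.iterate_injOn_Iio_minimalPeriod (f := f) (x := x) ?_ ?_ h <;>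
      rw [hn, mem_Iio] <;> omega
  · have : f^[n + 1] x = x := by rw [← hn]; exact Function.iterate_minimalPeriod
    rw [this, dist_self]
    exact hδ.le

end IntervalMaps

namespace IntervalMaps

/-! ### The Bernoulli shift -/

/-- The one-sided shift. -/
def shift {m : ℕ} (ω : ℕ → Fin m) : ℕ → Fin m := fun i => ω (i + 1)

theorem continuous_shift {m : ℕ} : Continuous (shift (m := m)) :=
  continuous_pi fun i => continuous_apply (i + 1)

theorem shift_iterate_apply {m : ℕ} (ω : ℕ → Fin m) (n i : ℕ) : shift^[n] ω i = ω (i + n) := by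
  induction n generalizing i with
  | zero => rfl
  | succ n ih => rw [Function.iterate_succ_apply', shift, ih]; congr 1; omega

variable {m : ℕ}

instance [NeZero m] : IsProbabilityMeasure (uniformBernoulli m) := by
  unfold uniformBernoulli; infer_instance

theorem uniformOfFintype_singleton [NeZero m] (i : Fin m) :
    (PMF.uniformOfFintype (Fin m)).toMeasure {i} = (m : ENNReal)⁻¹ := by
  rw [PMF.toMeasure_apply_singleton _ _ (measurableSet_singleton i), PMF.uniformOfFintype_apply,
    Fintype.card_fin]

theorem uniformBernoulli_cylinder [NeZero m] (n : ℕ) (w : Fin n → Fin m) :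
    uniformBernoulli m {ω | ∀ j : Fin n, ω j = w j} = (m : ENNReal)⁻¹ ^ n := by
  have : {ω : ℕ → Fin m | ∀ j : Fin n, ω j = w j} =
      Set.pi (Finset.range n : Set ℕ) fun j => if h : j < n then {w ⟨j, h⟩} else univ := by
    ext ω
    simp only [mem_ofPred_eq, Set.mem_pi, Finset.coe_range, mem_Iio]
    constructor
    · intro h j hj
      rw [dif_pos hj]
      exact h ⟨j, hj⟩
    · intro h j
      have := h j j.2
      rwa [dif_pos j.2] at this
  rw [this, uniformBernoulli, Measure.infinitePi_pi]
  · rw [Finset.prod_congr rfl (g := fun _ => (m : ENNReal)⁻¹)]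
    · simp
    · intro j hj
      rw [dif_pos (Finset.mem_range.1 hj), uniformOfFintype_singleton]
  · intro j hj
    rw [dif_pos (Finset.mem_range.1 hj)]
    exact measurableSet_singleton _

theorem uniformBernoulli_singleton [NeZero m] (hm : 2 ≤ m) (ω : ℕ → Fin m) :
    uniformBernoulli m {ω} = 0 := by
  have h : ∀ n : ℕ, uniformBernoulli m {ω} ≤ (m : ENNReal)⁻¹ ^ n := fun n => by
    rw [← uniformBernoulli_cylinder n fun j => ω j]
    exact measure_mono fun ω' h j => by rw [mem_singleton_iff.1 h]
  have hlt : (m : ENNReal)⁻¹ < 1 := by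
    rw [ENNReal.inv_lt_one]
    exact_mod_cast hm
  exact le_antisymm (ge_of_tendsto' (ENNReal.tendsto_pow_atTop_nhds_zero_of_lt_one hlt) h) bot_le

theorem uniformBernoulli_countable [NeZero m] (hm : 2 ≤ m) {S : Set (ℕ → Fin m)} (hS : S.Countable) :
    uniformBernoulli m S = 0 := by
  rw [← biUnion_of_singleton S, measure_biUnion_null_iff hS]
  exact fun ω _ => uniformBernoulli_singleton hm ω

theorem measurePreserving_shift [NeZero m] :
    MeasurePreserving shift (uniformBernoulli m) (uniformBernoulli m) := by
  refine ⟨continuous_shift.measurable, ?_⟩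
  conv_rhs => rw [uniformBernoulli]
  refine Measure.eq_infinitePi _ fun s t ht => ?_
  -- The shift moves the constrained coordinates up by one; the truncated value `j - 1` at `j = 0`
  -- is harmless, since `0` is not a successor.
  have : shift ⁻¹' (Set.pi s t) =
      Set.pi (s.map ⟨Nat.succ, Nat.succ_injective⟩ : Finset ℕ) (fun j => t (j - 1)) := by
    ext ω
    simp [Set.mem_pi, shift]
  rw [Measure.map_apply continuous_shift.measurable
    (MeasurableSet.pi s.countable_toSet fun i hi => ht i), this, uniformBernoulli,
    Measure.infinitePi_pi]
  · simp
  · intro j hj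
    exact ht _

/-! ### Horseshoes carry Bernoulli measures -/

/-- Take the last point of `[u, v]` with value `c`, then the first point after it with value `d`. If
`f` left `[c, d]` in between, the intermediate value theorem would give a later `c` or an earlier
`d`. -/
theorem exists_Icc_mapsTo (f : Maps) {u v c d : unitInterval} (huv : u ≤ v) (hcd : c ≤ d)
    (hu : f u ≤ c) (hv : d ≤ f v) :
    ∃ q : unitInterval × unitInterval, u ≤ q.1 ∧ q.1 ≤ q.2 ∧ q.2 ≤ v ∧ f q.1 = c ∧ f q.2 = d ∧
      MapsTo f (Icc q.1 q.2) (Icc c d) := by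
  have hf := f.continuous
  obtain ⟨u', ⟨⟨hu1, hu2⟩, hu3⟩, hu4⟩ : ∃ u', IsGreatest (Icc u v ∩ f ⁻¹' {c}) u' := by
    refine (isCompact_Icc.inter_right ((isClosed_singleton).preimage hf)).exists_isGreatest ?_
    obtain ⟨t, ht, htc⟩ := intermediate_value_Icc huv hf.continuousOn ⟨hu, hcd.trans hv⟩
    exact ⟨t, ht, htc⟩
  obtain ⟨v', ⟨⟨hv1, hv2⟩, hv3⟩, hv4⟩ : ∃ v', IsLeast (Icc u' v ∩ f ⁻¹' {d}) v' := by
    refine (isCompact_Icc.inter_right ((isClosed_singleton).preimage hf)).exists_isLeast ?_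
    obtain ⟨t, ht, htc⟩ := intermediate_value_Icc hu2 hf.continuousOn
      ⟨(le_of_eq hu3).trans hcd, hv⟩
    exact ⟨t, ht, htc⟩
  simp only [mem_preimage, mem_singleton_iff] at hu3 hv3
  refine ⟨(u', v'), hu1, hv1, hv2, hu3, hv3, fun t ht => ⟨?_, ?_⟩⟩
  · by_contra h
    rw [not_le] at h
    obtain ⟨s, hs, hsc⟩ := intermediate_value_Icc ht.2 hf.continuousOn
      ⟨h.le, hcd.trans hv3.ge⟩
    have : s ≤ u' := hu4 ⟨⟨hu1.trans (ht.1.trans hs.1), hs.2.trans hv2⟩, hsc⟩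
    have : t = u' := le_antisymm (hs.1.trans this) ht.1
    rw [this, hu3] at h
    exact lt_irrefl _ h
  · by_contra h
    rw [not_le] at h
    obtain ⟨s, hs, hsc⟩ := intermediate_value_Icc ht.1 hf.continuousOn
      ⟨hu3.le.trans hcd, h.le⟩
    have : v' ≤ s := hv4 ⟨⟨hs.1, hs.2.trans (ht.2.trans hv2)⟩, hsc⟩
    have : t = v' := le_antisymm ht.2 (this.trans hs.2)
    rw [this, hv3] at h
    exact lt_irrefl _ h

/-- Families of disjoint intervals each of which is stretched across all of them. -/
structure IsHorseshoe (f : Maps) (a b : Fin m → unitInterval) : Prop where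
  le : ∀ i, a i ≤ b i
  disjoint : ∀ i j, i ≠ j → Disjoint (Icc (a i) (b i)) (Icc (a j) (b j))
  left : ∀ i j, f (a i) ≤ a j
  right : ∀ i j, b j ≤ f (b i)

/-- An interval in `[q.1, q.2]` that `f` maps onto `[q'.1, q'.2]`. -/
def pullback (f : Maps) (q q' : unitInterval × unitInterval) : unitInterval × unitInterval :=
  open Classical in
  -- The default `q` is never met for a horseshoe, by `itineraryInterval_spec`.
  if h : q.1 ≤ q.2 ∧ q'.1 ≤ q'.2 ∧ f q.1 ≤ q'.1 ∧ q'.2 ≤ f q.2 then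
    (exists_Icc_mapsTo f h.1 h.2.1 h.2.2.1 h.2.2.2).choose else q

/-- The endpoints of the interval of the points whose itinerary starts like `ω`. -/
def itineraryInterval (f : Maps) (a b : Fin m → unitInterval) :
    ℕ → (ℕ → Fin m) → unitInterval × unitInterval
  | 0, ω => (a (ω 0), b (ω 0))
  | n + 1, ω => pullback f (itineraryInterval f a b n ω) (itineraryInterval f a b n (shift ω))

theorem pullback_spec (f : Maps) {q q' : unitInterval × unitInterval}
    (h : q.1 ≤ q.2 ∧ q'.1 ≤ q'.2 ∧ f q.1 ≤ q'.1 ∧ q'.2 ≤ f q.2) :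
    q.1 ≤ (pullback f q q').1 ∧ (pullback f q q').1 ≤ (pullback f q q').2 ∧
      (pullback f q q').2 ≤ q.2 ∧ f (pullback f q q').1 = q'.1 ∧ f (pullback f q q').2 = q'.2 ∧
      MapsTo f (Icc (pullback f q q').1 (pullback f q q').2) (Icc q'.1 q'.2) := by
  rw [pullback, dif_pos h]
  exact (exists_Icc_mapsTo f h.1 h.2.1 h.2.2.1 h.2.2.2).choose_spec

namespace IsHorseshoe

variable {f : Maps} {a b : Fin m → unitInterval}

/-- The induction closes because the endpoints of each pullback map exactly to the endpoints of the
target interval, and at the next level the target only shrinks. -/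
theorem itineraryInterval_spec (hH : IsHorseshoe f a b) (n : ℕ) : ∀ ω,
    (itineraryInterval f a b n ω).1 ≤ (itineraryInterval f a b n ω).2 ∧
    (itineraryInterval f a b n (shift ω)).1 ≤ (itineraryInterval f a b n (shift ω)).2 ∧
    f (itineraryInterval f a b n ω).1 ≤ (itineraryInterval f a b n (shift ω)).1 ∧
    (itineraryInterval f a b n (shift ω)).2 ≤ f (itineraryInterval f a b n ω).2 := by
  induction n with
  | zero => exact fun ω => ⟨hH.le _, hH.le _, hH.left _ _, hH.right _ _⟩
  | succ n ih =>
    intro ω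
    have h1 := pullback_spec f (ih ω)
    have h2 := pullback_spec f (ih (shift ω))
    refine ⟨h1.2.1, h2.2.1, ?_, ?_⟩
    · exact h1.2.2.2.1.trans_le h2.1
    · exact h2.2.2.1.trans_eq h1.2.2.2.2.1.symm

/-- The points with itinerary `ω` that lie in all the chosen intervals. -/
def fiber (f : Maps) (a b : Fin m → unitInterval) (ω : ℕ → Fin m) : Set unitInterval :=
  ⋂ n, Icc (itineraryInterval f a b n ω).1 (itineraryInterval f a b n ω).2

/-- The smallest point with itinerary `ω` in all the chosen intervals. -/
def point (f : Maps) (a b : Fin m → unitInterval) (ω : ℕ → Fin m) : unitInterval :=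
  ⨆ n, (itineraryInterval f a b n ω).1

theorem point_mem_fiber (hH : IsHorseshoe f a b) (ω : ℕ → Fin m) :
    point f a b ω ∈ fiber f a b ω :=
  Monotone.ciSup_mem_iInter_Icc_of_antitone
    (monotone_nat_of_le_succ fun n => (pullback_spec f (hH.itineraryInterval_spec n ω)).1)
    (antitone_nat_of_succ_le fun n => (pullback_spec f (hH.itineraryInterval_spec n ω)).2.2.1)
    fun n => (hH.itineraryInterval_spec n ω).1

theorem mapsTo_fiber (hH : IsHorseshoe f a b) (ω : ℕ → Fin m) :
    MapsTo f (fiber f a b ω) (fiber f a b (shift ω)) := fun _ hx =>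
  mem_iInter.2 fun n =>
    (pullback_spec f (hH.itineraryInterval_spec n ω)).2.2.2.2.2 (mem_iInter.1 hx (n + 1))

theorem iterate_mem (hH : IsHorseshoe f a b) {ω : ℕ → Fin m} {x : unitInterval}
    (hx : x ∈ fiber f a b ω) (n : ℕ) : f^[n] x ∈ Icc (a (ω n)) (b (ω n)) := by
  have h : ∀ n, f^[n] x ∈ fiber f a b (shift^[n] ω) := by
    intro n
    induction n with
    | zero => exact hx
    | succ n ih =>
      rw [Function.iterate_succ_apply', Function.iterate_succ_apply']
      exact hH.mapsTo_fiber _ ih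
  have h0 := mem_iInter.1 (h n) 0
  simpa [itineraryInterval, shift_iterate_apply] using h0

/-- The interval at level `n` depends on finitely many symbols only. This local constancy makes
`point` measurable, as a supremum of continuous functions. -/
theorem eventually_itineraryInterval_eq (f : Maps) (a b : Fin m → unitInterval) (n : ℕ) :
    ∀ ω, ∀ᶠ ω' in 𝓝 ω, itineraryInterval f a b n ω' = itineraryInterval f a b n ω := by
  induction n with
  | zero =>
    intro ω
    have : ∀ᶠ ω' in 𝓝 ω, ω' 0 = ω 0 :=
      (continuous_apply 0).tendsto ω ((isOpen_discrete {ω 0}).mem_nhds rfl)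
    filter_upwards [this] with ω' h
    simp [itineraryInterval, h]
  | succ n ih =>
    intro ω
    filter_upwards [ih ω, (continuous_shift.tendsto ω).eventually (ih (shift ω))] with ω' h1 h2
    simp [itineraryInterval, h1, h2]

theorem measurable_point (f : Maps) (a b : Fin m → unitInterval) : Measurable (point f a b) := by
  refine Measurable.iSup fun n => Continuous.measurable (Continuous.fst ?_)
  exact continuous_iff_continuousAt.2 fun ω =>
    (continuousAt_const.congr (Filter.EventuallyEq.symm (eventually_itineraryInterval_eq f a b n ω)))

theorem exists_code [NeZero m] (hH : IsHorseshoe f a b) : ∃ code : unitInterval → Fin m,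
    Measurable code ∧ ∀ i, ∀ x ∈ Icc (a i) (b i), code x = i := by
  obtain ⟨code, hc, h⟩ := exists_measurable_piecewise (fun i => Icc (a i) (b i))
    (fun i => measurableSet_Icc) (fun i (_ : unitInterval) => i) (fun i => measurable_const)
    (fun i j hij x hx => ((hH.disjoint i j hij).ne_of_mem hx.1 hx.2 rfl).elim)
  exact ⟨code, hc, fun i x hx => h i hx⟩

/-- Fibers of distinct itineraries are disjoint, and a fiber with two points contains an open
interval; only countably many disjoint sets can do so. -/
theorem countable_nontrivial_fiber (hH : IsHorseshoe f a b) :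
    {ω | (fiber f a b ω).Nontrivial}.Countable := by
  refine PairwiseDisjoint.countable_of_nonempty_interior (s := fiber f a b) ?_ ?_
  · intro ω _ ω' _ hne
    refine disjoint_left.2 fun x hx hx' => hne (funext fun n => ?_)
    by_contra h
    exact (hH.disjoint _ _ h).ne_of_mem (hH.iterate_mem hx n) (hH.iterate_mem hx' n) rfl
  · intro ω hω
    obtain ⟨x, hx, y, hy, hxy⟩ := (show (fiber f a b ω).Nontrivial from hω).exists_lt
    obtain ⟨z, hz⟩ := exists_between hxy
    refine ⟨z, mem_interior.2 ⟨Ioo x y, fun t ht => ?_, isOpen_Ioo, hz⟩⟩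
    exact mem_iInter.2 fun n => ⟨(mem_iInter.1 hx n).1.trans ht.1.le,
      ht.2.le.trans (mem_iInter.1 hy n).2⟩

/-- The measure is the image of the product measure under `point`, and reading off the itinerary
inverts `point` everywhere. Equivariance can fail only if the fiber of the shifted sequence is
nontrivial, which is a null event because countable sets are null and the shift preserves the
measure. -/
theorem exists_isBernoulli [NeZero m] (hH : IsHorseshoe f a b) (hm : 2 ≤ m) : ∃ μ : Measures,
    IsBernoulli f m μ ∧ ∀ᵐ x ∂(μ : Measure unitInterval), ∃ i, x ∈ Icc (a i) (b i) := by
  obtain ⟨code, hc, hcode⟩ := hH.exists_code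
  have hψ := measurable_point f a b
  set ψ := point f a b
  let φ : unitInterval → ℕ → Fin m := fun x n => code (f^[n] x)
  have hφ : Measurable φ := measurable_pi_lambda _ fun n =>
    hc.comp (f.continuous.iterate n).measurable
  have hφψ : ∀ ω, φ (ψ ω) = ω := fun ω => funext fun n =>
    hcode _ _ (hH.iterate_mem (hH.point_mem_fiber ω) n)
  have hfψ : ∀ᵐ ω ∂uniformBernoulli m, f (ψ ω) = ψ (shift ω) := by
    have h0 : ∀ᵐ ω ∂uniformBernoulli m, ω ∉ {ω | (fiber f a b ω).Nontrivial} :=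
      measure_eq_zero_iff_ae_notMem.1 (uniformBernoulli_countable hm hH.countable_nontrivial_fiber)
    have h1 := measurePreserving_shift.quasiMeasurePreserving.ae h0
    filter_upwards [h1] with ω hω
    exact (not_nontrivial_iff.1 hω) (hH.mapsTo_fiber _ (hH.point_mem_fiber ω))
      (hH.point_mem_fiber (shift ω))
  let μ : Measures := ⟨(uniformBernoulli m).map ψ, Measure.isProbabilityMeasure_map hψ.aemeasurable⟩
  have hμ : (μ : Measure unitInterval) = (uniformBernoulli m).map ψ := rfl
  refine ⟨μ, ⟨⟨f.continuous.measurable, ?_⟩, φ, ψ, ⟨hφ, ?_⟩, hψ, ?_, ?_, ?_⟩, ?_⟩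
  · rw [hμ, Measure.map_map f.continuous.measurable hψ]
    calc (uniformBernoulli m).map (f ∘ ψ) = (uniformBernoulli m).map (ψ ∘ shift) :=
          Measure.map_congr hfψ
      _ = (uniformBernoulli m).map ψ := by
          rw [← Measure.map_map hψ continuous_shift.measurable, measurePreserving_shift.map_eq]
  · rw [hμ, Measure.map_map hφ hψ, show φ ∘ ψ = id from funext hφψ, Measure.map_id]
  · exact Eventually.of_forall fun x => rfl
  · have hs : MeasurableSet {x | ψ (φ x) = x} := measurableSet_eq_fun (hψ.comp hφ) measurable_id
    rw [hμ, ae_map_iff hψ.aemeasurable hs]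
    exact Eventually.of_forall fun ω => by rw [hφψ]
  · exact Eventually.of_forall hφψ
  · have : MeasurableSet {x | ∃ i, x ∈ Icc (a i) (b i)} := by
      have h : {x | ∃ i, x ∈ Icc (a i) (b i)} = ⋃ i, Icc (a i) (b i) := by ext; simp
      rw [h]
      exact MeasurableSet.iUnion fun i => measurableSet_Icc
    rw [hμ, ae_map_iff hψ.aemeasurable this]
    exact Eventually.of_forall fun ω => ⟨ω 0, hH.iterate_mem (hH.point_mem_fiber ω) 0⟩

end IsHorseshoe

/-! ### Horseshoes near fixed points -/

/-- The maps with a stable horseshoe in `U`. -/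
def horseshoes (m : ℕ) (U : Set unitInterval) : Set Maps :=
  {f | ∃ a b : Fin m → unitInterval, ((∀ i, a i ≤ b i) ∧
    (∀ i j, i ≠ j → Disjoint (Icc (a i) (b i)) (Icc (a j) (b j))) ∧ ∀ i, Icc (a i) (b i) ⊆ U) ∧
    ∀ i j, f (a i) < a j ∧ b j < f (b i)}

theorem isOpen_horseshoes (m : ℕ) (U : Set unitInterval) : IsOpen (horseshoes m U) := by
  have : horseshoes m U = ⋃ (a : Fin m → unitInterval) (b : Fin m → unitInterval)
      (_ : (∀ i, a i ≤ b i) ∧ (∀ i j, i ≠ j → Disjoint (Icc (a i) (b i)) (Icc (a j) (b j))) ∧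
        ∀ i, Icc (a i) (b i) ⊆ U),
      ⋂ (i : Fin m) (j : Fin m), {f : Maps | f (a i) < a j} ∩ {f : Maps | b j < f (b i)} := by
    ext f
    simp only [horseshoes, mem_ofPred_eq, mem_iUnion, mem_iInter, mem_inter_iff, exists_prop]
  rw [this]
  refine isOpen_iUnion fun a => isOpen_iUnion fun b => isOpen_iUnion fun _ =>
    isOpen_iInter_of_finite fun i => isOpen_iInter_of_finite fun j => ?_
  exact (isOpen_lt (continuous_eval_const _) continuous_const).inter
    (isOpen_lt continuous_const (continuous_eval_const _))

/-- The interval is taken on one side of `x`, since `x` may be an endpoint of `[0,1]`. -/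
theorem exists_Icc_subset_of_mem_nhds {x : unitInterval} {V : Set unitInterval} (hV : V ∈ 𝓝 x) :
    ∃ c d, c < d ∧ Icc c d ⊆ V := by
  rcases lt_or_eq_of_le (le_top : x ≤ ⊤) with h | h
  · obtain ⟨u, hu, hs⟩ := exists_Ico_subset_of_mem_nhds hV ⟨_, h⟩
    obtain ⟨d, hxd, hdu⟩ := exists_between hu
    exact ⟨x, d, hxd, fun y hy => hs ⟨hy.1, hy.2.trans_lt hdu⟩⟩
  · have h' : (⊥ : unitInterval) < x := h ▸ bot_lt_top
    obtain ⟨u, hu, hs⟩ := exists_Ioc_subset_of_mem_nhds hV ⟨_, h'⟩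
    obtain ⟨c, huc, hcx⟩ := exists_between hu
    exact ⟨c, x, hcx, fun y hy => hs ⟨huc.trans_le hy.1, hy.2⟩⟩

/-- Choose `[c, d]` so close to the fixed point that both it and its image lie in the `δ/4`-ball.
Altering `f` to take the values `c` and `d` alternately at `2m` interior points costs at most `δ/2`,
and consecutive pairs of these points bound the intervals of the horseshoe. -/
theorem mem_closure_horseshoes {f : Maps} {x : unitInterval} (hx : f x = x) (m : ℕ)
    {U : Set unitInterval} (hU : U ∈ 𝓝 x) : f ∈ closure (horseshoes m U) := by
  classical
  refine Metric.mem_closure_iff.2 fun δ hδ => ?_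
  have hV : U ∩ (Metric.ball x (δ / 4) ∩ f ⁻¹' Metric.ball x (δ / 4)) ∈ 𝓝 x := by
    refine inter_mem hU (inter_mem (Metric.ball_mem_nhds x (by positivity)) ?_)
    refine f.continuous.tendsto x ?_
    rw [hx]
    exact Metric.ball_mem_nhds x (by positivity)
  obtain ⟨c, d, hcd, hsub⟩ := exists_Icc_subset_of_mem_nhds hV
  have : Nonempty (Ioo c d) := nonempty_Ioo_subtype hcd
  obtain ⟨s, hs⟩ := Nat.exists_strictMono (Ioo c d)
  let p : ℕ → unitInterval := fun k => (s k : unitInterval)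
  have hp : StrictMono p := hs
  have hpI : ∀ k, c < p k ∧ p k < d := fun k => (s k).2
  obtain ⟨g, hgf, hg⟩ := exists_dist_le_of_finite f
    ((Finset.range (2 * m)).image p).finite_toSet
    (fun y => if ∃ i, y = p (2 * i) then c else d) (show 0 ≤ δ / 2 by positivity) (by
      intro y hy
      obtain ⟨k, -, rfl⟩ := Finset.mem_image.1 (Finset.mem_coe.1 hy)
      have h1 := (hsub ⟨(hpI k).1.le, (hpI k).2.le⟩).2.2
      have h2 : ∀ z ∈ Icc c d, dist z (f (p k)) ≤ δ / 2 := fun z hz => by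
        have h3 := (hsub hz).2.1
        rw [Metric.mem_ball] at h3
        rw [mem_preimage, Metric.mem_ball] at h1
        linarith [dist_triangle_right z (f (p k)) x]
      split_ifs
      · exact h2 c (left_mem_Icc.2 hcd.le)
      · exact h2 d (right_mem_Icc.2 hcd.le))
  have hgc : ∀ i < m, g (p (2 * i)) = c := fun i hi => by
    rw [hg _ (by simpa using ⟨2 * i, by omega, rfl⟩), if_pos ⟨i, rfl⟩]
  have hgd : ∀ i < m, g (p (2 * i + 1)) = d := fun i hi => by
    rw [hg _ (by simpa using ⟨2 * i + 1, by omega, rfl⟩), if_neg]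
    rintro ⟨j, hj⟩
    have := hp.injective hj
    omega
  refine ⟨g, ⟨fun i => p (2 * i), fun i => p (2 * i + 1), ⟨fun i => ?_, fun i j hij => ?_,
    fun i y hy => ?_⟩, fun i j => ⟨?_, ?_⟩⟩, by rw [dist_comm]; linarith⟩
  · exact hp.monotone (Nat.le_succ _)
  · refine disjoint_left.2 fun y hy hy' => ?_
    have h1 := hp.le_iff_le.1 (hy.1.trans hy'.2)
    have h2 := hp.le_iff_le.1 (hy'.1.trans hy.2)
    exact hij (Fin.ext (by omega))
  · exact (hsub ⟨(hpI _).1.le.trans hy.1, hy.2.trans (hpI _).2.le⟩).1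
  · rw [hgc i i.2]; exact (hpI _).1
  · rw [hgd i i.2]; exact (hpI _).2

theorem exists_isBernoulli_of_mem_horseshoes {m : ℕ} [NeZero m] (hm : 2 ≤ m) {f : Maps}
    {U : Set unitInterval} (hf : f ∈ horseshoes m U) : ∃ μ : Measures,
      IsBernoulli f m μ ∧ ∀ᵐ x ∂(μ : Measure unitInterval), x ∈ U := by
  obtain ⟨a, b, ⟨hle, hd, hU⟩, h⟩ := hf
  have hH : IsHorseshoe f a b := ⟨hle, hd, fun i j => (h i j).1.le, fun i j => (h i j).2.le⟩
  obtain ⟨μ, hμ, hs⟩ := hH.exists_isBernoulli hm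
  exact ⟨μ, hμ, hs.mono fun x ⟨i, hi⟩ => hU i hi⟩

theorem tendsto_diracProba {x : unitInterval} {μ : ℕ → Measures} {U : ℕ → Set unitInterval}
    (hU : ∀ V ∈ 𝓝 x, ∀ᶠ n in atTop, U n ⊆ V)
    (hμ : ∀ n, ∀ᵐ y ∂(μ n : Measure unitInterval), y ∈ U n) :
    Tendsto μ atTop (𝓝 (diracProba x)) := by
  refine ProbabilityMeasure.tendsto_iff_forall_integral_tendsto.2 fun g => ?_
  have hx : ∫ y, g y ∂(diracProba x : Measure unitInterval) = g x := integral_dirac _ _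
  rw [hx]
  refine Metric.tendsto_nhds.2 fun ε hε => ?_
  filter_upwards [hU _ (g.continuous.tendsto x (Metric.closedBall_mem_nhds _ (half_pos hε)))]
    with n hn
  have hc : g x = ∫ _, g x ∂(μ n : Measure unitInterval) := by simp
  have hle : ‖∫ y, (g y - g x) ∂(μ n : Measure unitInterval)‖ ≤
      ε / 2 * (μ n : Measure unitInterval).real univ :=
    norm_integral_le_of_norm_le_const ((hμ n).mono fun y hy => by
      rw [← dist_eq_norm]; exact hn hy)
  rw [hc, dist_eq_norm, ← integral_sub (g.integrable _) (integrable_const _)]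
  refine lt_of_le_of_lt hle ?_
  simp
  linarith

end IntervalMaps

namespace IntervalMaps

/-! ### The mean ergodic theorem -/

section MeanErgodic

variable {α : Type*} [MeasurableSpace α] {μ : Measure α} [IsProbabilityMeasure μ] {T : α → α}

theorem measurable_birkhoffAverage (hT : Measurable T) {G : α → ℝ} (hG : Measurable G) (n : ℕ) :
    Measurable (birkhoffAverage ℝ T G n) := by
  have : birkhoffAverage ℝ T G n = fun x => (n : ℝ)⁻¹ * ∑ j ∈ Finset.range n, G (T^[j] x) := rfl
  rw [this]
  exact measurable_const.mul
    (Finset.measurable_sum _ fun j _ => hG.comp (hT.iterate j))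

theorem abs_birkhoffAverage_le {α : Type*} {T : α → α} {G : α → ℝ} {C : ℝ} (hC0 : 0 ≤ C)
    (hC : ∀ x, |G x| ≤ C) (n : ℕ) (x : α) : |birkhoffAverage ℝ T G n x| ≤ C := by
  rw [birkhoffAverage, birkhoffSum, smul_eq_mul, abs_mul, abs_of_nonneg (by positivity)]
  rcases Nat.eq_zero_or_pos n with rfl | hn
  · simpa using hC0
  · rw [inv_mul_le_iff₀ (by positivity)]
    calc |∑ j ∈ Finset.range n, G (T^[j] x)| ≤ ∑ j ∈ Finset.range n, |G (T^[j] x)| :=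
          Finset.abs_sum_le_sum_abs _ _
      _ ≤ ∑ j ∈ Finset.range n, C := Finset.sum_le_sum fun j _ => hC _
      _ = n * C := by simp

theorem integral_abs_le_norm_toLp {h : α → ℝ} (hh : MemLp h 2 μ) :
    ∫ x, |h x| ∂μ ≤ ‖hh.toLp h‖ := by
  rw [Lp.norm_toLp]
  have h1 : ∫ x, |h x| ∂μ = (eLpNorm h 1 μ).toReal := by
    rw [eLpNorm_one_eq_lintegral_enorm, ← integral_norm_eq_lintegral_enorm hh.1]
    rfl
  rw [h1]
  exact ENNReal.toReal_mono hh.2.ne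
    (eLpNorm_le_eLpNorm_of_exponent_le (by norm_num) hh.1)

/-- Von Neumann's theorem in `L²`: the averages converge to the projection of `G` onto the vectors
fixed by composition with `T`, which are constant by ergodicity. The `L²` norm dominates the `L¹`
norm, and comparing integrals identifies the constant. -/
theorem tendsto_integral_abs_birkhoffAverage (hT : Ergodic T μ) {G : α → ℝ} (hG : Measurable G)
    {C : ℝ} (hC : ∀ x, |G x| ≤ C) :
    Tendsto (fun n => ∫ x, |birkhoffAverage ℝ T G n x - ∫ y, G y ∂μ| ∂μ) atTop (𝓝 0) := by
  obtain ⟨x₀⟩ : Nonempty α := nonempty_of_isProbabilityMeasure μ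
  have hC0 : 0 ≤ C := (abs_nonneg _).trans (hC x₀)
  have hm : MeasurePreserving T μ μ := hT.toMeasurePreserving
  have hA : ∀ n, MemLp (birkhoffAverage ℝ T G n) 2 μ := fun n =>
    MemLp.of_bound (measurable_birkhoffAverage hm.measurable hG n).aestronglyMeasurable C
      (Eventually.of_forall fun x => abs_birkhoffAverage_le hC0 hC n x)
  have hGm : MemLp G 2 μ := MemLp.of_bound hG.aestronglyMeasurable C (Eventually.of_forall hC)
  let U := (Lp.compMeasurePreservingₗᵢ ℝ T hm : Lp ℝ 2 μ →ₗᵢ[ℝ] Lp ℝ 2 μ).toContinuousLinearMap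
  have hU : ∀ g, U g = Lp.compMeasurePreserving T hm g := fun g => rfl
  have hiter : ∀ n, (U^[n]) (hGm.toLp G) =ᵐ[μ] fun x => G (T^[n] x) := by
    intro n
    have h1 : (U^[n]) = (Lp.compMeasurePreserving (E := ℝ) (p := 2) T hm)^[n] := rfl
    rw [h1, Lp.compMeasurePreserving_iterate hm n, Lp.toLp_compMeasurePreserving]
    exact MemLp.coeFn_toLp _
  have hav : ∀ n, birkhoffAverage ℝ U id n (hGm.toLp G) = (hA n).toLp _ := by
    intro n
    refine Lp.ext ?_
    refine EventuallyEq.trans ?_ (MemLp.coeFn_toLp _).symm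
    rw [birkhoffAverage, birkhoffSum]
    refine (Lp.coeFn_smul _ _).trans ?_
    have hsum := Lp.coeFn_finsetSum (Finset.range n) fun k => id (U^[k] (hGm.toLp G))
    filter_upwards [hsum, ae_all_iff.2 hiter] with x hx hi
    rw [Pi.smul_apply, hx, birkhoffAverage, birkhoffSum, Finset.sum_apply]
    simp only [id, hi]
  have hnorm : ‖U‖ ≤ 1 := LinearIsometry.norm_toContinuousLinearMap_le _
  have hlim := U.tendsto_birkhoffAverage_orthogonalProjection hnorm (hGm.toLp G)
  set P : Lp ℝ 2 μ := ((U.eqLocus (1 : Lp ℝ 2 μ →L[ℝ] Lp ℝ 2 μ)).orthogonalProjectionOnto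
    (hGm.toLp G) : Lp ℝ 2 μ) with hP
  have hPfix : U P = P := by
    exact ((U.eqLocus (1 : Lp ℝ 2 μ →L[ℝ] Lp ℝ 2 μ)).orthogonalProjectionOnto
      (hGm.toLp G)).2
  obtain ⟨c, hc⟩ := hT.ae_eq_const_of_ae_eq_comp_ae (Lp.aestronglyMeasurable P)
    (by
      have h1 := Lp.coeFn_compMeasurePreserving P hm
      rw [← hU, hPfix] at h1
      exact h1.symm)
  have hcm : ∀ n, MemLp (fun x => birkhoffAverage ℝ T G n x - c) 2 μ := fun n =>
    (hA n).sub (memLp_const c)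
  have hsub : ∀ n, birkhoffAverage ℝ U id n (hGm.toLp G) - P = (hcm n).toLp _ := by
    intro n
    rw [hav]
    refine Lp.ext ?_
    filter_upwards [Lp.coeFn_sub ((hA n).toLp _) P, (hA n).coeFn_toLp, (hcm n).coeFn_toLp, hc]
      with x h1 h2 h3 h4
    rw [h1, h3, Pi.sub_apply, h2, h4]
    rfl
  have hconv : Tendsto (fun n => ∫ x, |birkhoffAverage ℝ T G n x - c| ∂μ) atTop (𝓝 0) := by
    refine squeeze_zero (fun n => integral_nonneg fun x => abs_nonneg _)
      (fun n => integral_abs_le_norm_toLp (hcm n)) ?_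
    simp_rw [← hsub]
    simpa using (hlim.sub_const P).norm
  have hGi : Integrable G μ := hGm.integrable (by norm_num)
  have hint : ∀ n, 0 < n → ∫ x, birkhoffAverage ℝ T G n x ∂μ = ∫ y, G y ∂μ := by
    intro n hn
    have h1 : ∀ j, ∫ x, G (T^[j] x) ∂μ = ∫ y, G y ∂μ := fun j => by
      conv_rhs => rw [← (hm.iterate j).map_eq]
      rw [integral_map (hm.iterate j).measurable.aemeasurable hG.aestronglyMeasurable]
    have h2 : ∀ j, Integrable (fun x => G (T^[j] x)) μ := fun j =>
      (hm.iterate j).integrable_comp_of_integrable hGi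
    simp only [birkhoffAverage, birkhoffSum, smul_eq_mul]
    rw [integral_const_mul, integral_finsetSum _ fun j _ => h2 j]
    simp only [h1, Finset.sum_const, Finset.card_range, nsmul_eq_mul]
    field_simp
  have hceq : c = ∫ y, G y ∂μ := by
    have h0 : Tendsto (fun _ : ℕ => |(∫ y, G y ∂μ) - c|) atTop (𝓝 0) := by
      refine squeeze_zero' (Eventually.of_forall fun n => abs_nonneg _) ?_ hconv
      filter_upwards [eventually_gt_atTop 0] with n hn
      rw [← hint n hn]
      have : c = ∫ _, c ∂μ := by simp
      conv_lhs => rw [this]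
      rw [← integral_sub ((hA n).integrable (by norm_num)) (integrable_const _)]
      exact abs_integral_le_integral_abs
    have := tendsto_nhds_unique h0 tendsto_const_nhds
    exact (sub_eq_zero.1 (abs_eq_zero.1 this.symm)).symm
  rwa [hceq] at hconv

/-- The Cesàro means of these measures converge to `μ(U)² > 0`, by integrating the mean ergodic
theorem for the indicator of `U` against that indicator. -/
theorem not_tendsto_measureReal_inter_preimage (hT : Ergodic T μ) {U : Set α}
    (hUm : MeasurableSet U) (hUpos : 0 < μ.real U) :
    ¬ Tendsto (fun n => μ.real (U ∩ T^[n] ⁻¹' U)) atTop (𝓝 0) := by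
  intro ha
  have hm : MeasurePreserving T μ μ := hT.toMeasurePreserving
  let G : α → ℝ := U.indicator 1
  have hG : Measurable G := measurable_one.indicator hUm
  have hG1 : ∀ x, |G x| ≤ 1 := fun x => by
    by_cases hx : x ∈ U <;> simp [G, hx]
  have hGint : ∫ x, G x ∂μ = μ.real U := integral_indicator_one hUm
  have hav := tendsto_integral_abs_birkhoffAverage hT hG hG1
  rw [hGint] at hav
  have hmj : ∀ j, MeasurableSet (U ∩ T^[j] ⁻¹' U) := fun j =>
    hUm.inter ((hm.measurable.iterate j) hUm)
  have hprod : ∀ n, ∫ x, G x * birkhoffAverage ℝ T G n x ∂μ =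
      (n : ℝ)⁻¹ * ∑ j ∈ Finset.range n, μ.real (U ∩ T^[j] ⁻¹' U) := by
    intro n
    have h1 : ∀ j x, G x * G (T^[j] x) = (U ∩ T^[j] ⁻¹' U).indicator 1 x := fun j x => by
      by_cases h1 : x ∈ U <;> by_cases h2 : T^[j] x ∈ U <;> simp [G, h1, h2]
    have h2 : ∀ x, G x * birkhoffAverage ℝ T G n x =
        (n : ℝ)⁻¹ * ∑ j ∈ Finset.range n, (U ∩ T^[j] ⁻¹' U).indicator (1 : α → ℝ) x := by
      intro x
      simp_rw [← h1, birkhoffAverage, birkhoffSum, smul_eq_mul, ← Finset.mul_sum]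
      ring
    simp_rw [h2]
    rw [integral_const_mul, integral_finsetSum]
    · simp only [integral_indicator_one (hmj _)]
    · exact fun j _ => (integrable_const (1 : ℝ)).indicator (hmj j)
  have hlim : Tendsto (fun n : ℕ => (n : ℝ)⁻¹ * ∑ j ∈ Finset.range n, μ.real (U ∩ T^[j] ⁻¹' U))
      atTop (𝓝 (μ.real U * μ.real U)) := by
    rw [tendsto_iff_norm_sub_tendsto_zero]
    refine squeeze_zero (fun n => norm_nonneg _) (fun n => ?_) hav
    have hAm := measurable_birkhoffAverage hm.measurable hG n
    have hAb := abs_birkhoffAverage_le (T := T) (n := n) zero_le_one hG1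
    have hi1 : Integrable (fun x => G x * birkhoffAverage ℝ T G n x) μ :=
      Integrable.of_bound (hG.mul hAm).aestronglyMeasurable 1 (Eventually.of_forall fun x => by
        rw [Real.norm_eq_abs, abs_mul]
        exact mul_le_one₀ (hG1 x) (abs_nonneg _) (hAb x))
    have hi2 : Integrable G μ :=
      Integrable.of_bound hG.aestronglyMeasurable 1 (Eventually.of_forall hG1)
    have hi3 : Integrable (fun x => |birkhoffAverage ℝ T G n x - μ.real U|) μ :=
      ((Integrable.of_bound hAm.aestronglyMeasurable 1 (Eventually.of_forall hAb)).sub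
        (integrable_const _)).abs
    have heq : (n : ℝ)⁻¹ * ∑ j ∈ Finset.range n, μ.real (U ∩ T^[j] ⁻¹' U) - μ.real U * μ.real U =
        ∫ x, G x * (birkhoffAverage ℝ T G n x - μ.real U) ∂μ := by
      simp_rw [mul_sub]
      rw [integral_sub hi1 (hi2.mul_const _), integral_mul_const, hprod, hGint]
    rw [heq]
    refine (norm_integral_le_integral_norm _).trans ?_
    refine integral_mono_of_nonneg (Eventually.of_forall fun x => norm_nonneg _) hi3
      (Eventually.of_forall fun x => ?_)
    dsimp only
    rw [norm_mul]
    exact mul_le_of_le_one_left (abs_nonneg _) (hG1 x)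
  exact (mul_pos hUpos hUpos).ne (tendsto_nhds_unique ha.cesaro hlim)

end MeanErgodic

/-! ### Ergodicity of Bernoulli measures -/

variable {m : ℕ} [NeZero m]

/-- An invariant set equals its preimage under `shift^[n]`, so it depends only on the coordinates
from `n` on, for every `n`. It is a tail event, and Kolmogorov's zero-one law applies. -/
theorem ergodic_shift : Ergodic shift (uniformBernoulli m) := by
  refine ⟨measurePreserving_shift, ⟨fun s hs hinv => ?_⟩⟩
  have hind : ProbabilityTheory.iIndepFun (fun (i : ℕ) (ω : ℕ → Fin m) => ω i)
      (uniformBernoulli m) :=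
    ProbabilityTheory.iIndepFun_infinitePi (X := fun _ ω => ω) fun _ => measurable_id
  have hinv' : ∀ n, shift^[n] ⁻¹' s = s := fun n => by
    induction n with
    | zero => rfl
    | succ n ih => rw [Function.iterate_succ, preimage_comp, ih, hinv]
  have h01 := ProbabilityTheory.measure_zero_or_one_of_measurableSet_limsup_atTop
    (fun n => (measurable_pi_apply n).comap_le) hind (t := s) (by
      rw [limsup_eq_iInf_iSup_of_nat, MeasurableSpace.measurableSet_iInf]
      intro n
      have hmeas : Measurable[⨆ i ≥ n, MeasurableSpace.comap (fun ω : ℕ → Fin m => ω i) ⊤]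
          (shift^[n] : (ℕ → Fin m) → ℕ → Fin m) := by
        refine @measurable_pi_lambda _ _ _ (_) _ _ fun i => ?_
        have : (fun ω : ℕ → Fin m => shift^[n] ω i) = fun ω => ω (i + n) := by
          ext ω; rw [shift_iterate_apply]
        rw [this]
        exact (comap_measurable _).mono
          (le_iSup₂_of_le (i + n) (Nat.le_add_left n i) le_rfl) le_rfl
      rw [← hinv' n]
      exact hmeas hs)
  rw [eventuallyConst_set]
  rcases h01 with h | h
  · exact Or.inr (measure_eq_zero_iff_ae_notMem.1 h)
  · exact Or.inl ((mem_ae_iff_prob_eq_one hs).2 h)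

variable {f : Maps} {μ : Measures}

theorem IsBernoulli.ergodic (h : IsBernoulli f m μ) : Ergodic f (μ : Measure unitInterval) := by
  obtain ⟨hμ, φ, ψ, hφ, hψ, hφf, hψφ, hφψ⟩ := h
  have hψm : (uniformBernoulli m).map ψ = μ := by
    rw [← hφ.map_eq, Measure.map_map hψ hφ.measurable]
    exact (Measure.map_congr hψφ).trans Measure.map_id
  have hψp : MeasurePreserving ψ (uniformBernoulli m) μ := ⟨hψ, hψm⟩
  have hfψ : ∀ᵐ ω ∂uniformBernoulli m, ψ (shift ω) = f (ψ ω) := by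
    have hμ' : MeasurePreserving f (μ : Measure unitInterval) μ := hμ
    have h1 := hψp.quasiMeasurePreserving.ae hφf
    have h2 := (hμ'.comp hψp).quasiMeasurePreserving.ae hψφ
    filter_upwards [h1, h2, hφψ] with ω h1 h2 h3
    rw [Function.comp_apply, h1, h3] at h2
    exact h2
  refine ⟨hμ, ⟨fun s hs hinv => ?_⟩⟩
  have := ergodic_shift.quasiErgodic.ae_mem_or_ae_notMem₀ (hψ hs).nullMeasurableSet (by
    filter_upwards [hfψ] with ω hω
    change (ψ (shift ω) ∈ s) = (ψ ω ∈ s)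
    rw [hω]
    exact congrFun hinv (ψ ω))
  rw [eventuallyConst_set, ← hψm]
  exact this.imp (ae_map_iff hψ.aemeasurable (p := (· ∈ s)) hs).2
    (ae_map_iff hψ.aemeasurable (p := (· ∉ s)) hs.compl).2

theorem IsBernoulli.ae_coding (h : IsBernoulli f m μ) : ∃ (φ : unitInterval → ℕ → Fin m)
    (ψ : (ℕ → Fin m) → unitInterval),
    MeasurePreserving φ (μ : Measure unitInterval) (uniformBernoulli m) ∧ Measurable ψ ∧
    (∀ᵐ x ∂(μ : Measure unitInterval), ψ (φ x) = x) ∧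
    ∀ᵐ x ∂(μ : Measure unitInterval), ∀ n, φ (f^[n] x) = shift^[n] (φ x) := by
  obtain ⟨hμ, φ, ψ, hφ, hψ, hφf, hψφ, hφψ⟩ := h
  have hμ' : MeasurePreserving f (μ : Measure unitInterval) μ := hμ
  refine ⟨φ, ψ, hφ, hψ, hψφ, ?_⟩
  filter_upwards [ae_all_iff.2 fun n => (hμ'.iterate n).quasiMeasurePreserving.ae hφf] with x hx n
  induction n with
  | zero => rfl
  | succ n ih =>
    rw [Function.iterate_succ_apply', Function.iterate_succ_apply', hx n, ← ih]
    rfl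

/-- For fixed `i < j` such a sequence is determined by its first `j` symbols, since `ω n = ω (n - j
+ i)` for `n ≥ j`. -/
theorem countable_preperiodic (k : ℕ) :
    {ω : ℕ → Fin k | ∃ i j, i < j ∧ shift^[i] ω = shift^[j] ω}.Countable := by
  have h : {ω : ℕ → Fin k | ∃ i j, i < j ∧ shift^[i] ω = shift^[j] ω} =
      ⋃ (i : ℕ) (j : ℕ), {ω | i < j ∧ shift^[i] ω = shift^[j] ω} := by ext; simp
  rw [h]
  refine countable_iUnion fun i => countable_iUnion fun j => ?_
  refine MapsTo.countable_of_injOn (f := fun ω (l : Fin j) => ω l) (fun _ _ => mem_univ _)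
    (fun ω hω ω' hω' heq => ?_) countable_univ
  obtain ⟨hij, hω⟩ := hω
  obtain ⟨-, hω'⟩ := hω'
  funext n
  induction n using Nat.strong_induction_on with
  | _ n ih =>
    by_cases hn : n < j
    · exact congrFun heq ⟨n, hn⟩
    · have h1 := congrFun hω (n - j)
      have h2 := congrFun hω' (n - j)
      rw [shift_iterate_apply, shift_iterate_apply, Nat.sub_add_cancel (not_lt.1 hn)] at h1 h2
      rw [← h1, ← h2]
      exact ih _ (by omega)

theorem IsBernoulli.ae_injective (hm : 2 ≤ m) (h : IsBernoulli f m μ) :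
    ∀ᵐ x ∂(μ : Measure unitInterval), ∀ i j, f^[i] x = f^[j] x → i = j := by
  obtain ⟨φ, ψ, hφ, -, -, hφf⟩ := h.ae_coding
  have h0 := hφ.quasiMeasurePreserving.ae (measure_eq_zero_iff_ae_notMem.1
    (uniformBernoulli_countable hm (countable_preperiodic m)))
  filter_upwards [h0, hφf] with x hx hxf i j hij
  have hs : shift^[i] (φ x) = shift^[j] (φ x) := by rw [← hxf, ← hxf, hij]
  by_contra hne
  rcases lt_or_gt_of_ne hne with hlt | hlt
  · exact hx ⟨i, j, hlt, hs⟩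
  · exact hx ⟨j, i, hlt, hs.symm⟩

/-! ### Closing orbit segments -/

variable (Ψ : ℕ → Maps)

theorem integral_empirical_eq_birkhoffAverage (f : Maps) (x : unitInterval) (n : ℕ)
    (g : unitInterval → ℝ) :
    ∫ y, g y ∂(empirical f x n : Measure unitInterval) = birkhoffAverage ℝ f g (n + 1) x := by
  rw [integral_empirical, birkhoffAverage, birkhoffSum, smul_eq_mul]
  push_cast
  rfl

/-- The mean ergodic theorem handles each term of the series; the bounds `2^{-(i+1)}` justify
exchanging the sum with the integral and with the limit. -/
theorem tendsto_integral_weakDist_empirical (hf : Ergodic f (μ : Measure unitInterval)) :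
    Tendsto (fun n => ∫ x, weakDist Ψ (empirical f x n) μ ∂(μ : Measure unitInterval)) atTop
      (𝓝 0) := by
  let D : ℕ → ℕ → unitInterval → ℝ := fun n i x => (1 / 2 : ℝ) ^ (i + 1) *
    |birkhoffAverage ℝ f (fun y => (Ψ i y : ℝ)) (n + 1) x -
      ∫ y, (Ψ i y : ℝ) ∂(μ : Measure unitInterval)|
  have hD : ∀ n x, weakDist Ψ (empirical f x n) μ = ∑' i, D n i x := fun n x => by
    simp only [weakDist, integral_empirical_eq_birkhoffAverage f x n fun y => (Ψ _ y : ℝ)]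
    rfl
  have hD0 : ∀ n i x, 0 ≤ D n i x := fun n i x => by positivity
  have hD1 : ∀ n i x, D n i x ≤ (1 / 2 : ℝ) ^ (i + 1) := fun n i x => by
    have := weakDist_term_le (Ψ i) (empirical f x n) μ i
    rwa [integral_empirical_eq_birkhoffAverage f x n fun y => (Ψ i y : ℝ)] at this
  have hDm : ∀ n i, Measurable (D n i) := fun n i => by
    refine measurable_const.mul (Measurable.abs (Measurable.sub_const ?_ _))
    exact measurable_birkhoffAverage f.continuous.measurable
      (continuous_subtype_val.comp (Ψ i).continuous).measurable _
  have hDi : ∀ n i, Integrable (D n i) (μ : Measure unitInterval) := fun n i =>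
    Integrable.of_bound (hDm n i).aestronglyMeasurable ((1 / 2 : ℝ) ^ (i + 1))
      (Eventually.of_forall fun x => by rw [Real.norm_of_nonneg (hD0 n i x)]; exact hD1 n i x)
  have hIle : ∀ n i, ∫ x, D n i x ∂(μ : Measure unitInterval) ≤ (1 / 2 : ℝ) ^ (i + 1) :=
    fun n i => by
      calc ∫ x, D n i x ∂(μ : Measure unitInterval)
          ≤ ∫ _, (1 / 2 : ℝ) ^ (i + 1) ∂(μ : Measure unitInterval) :=
            integral_mono (hDi n i) (integrable_const _) (hD1 n i)
        _ = _ := by simp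
  have hswap : ∀ n, ∫ x, weakDist Ψ (empirical f x n) μ ∂(μ : Measure unitInterval) =
      ∑' i, ∫ x, D n i x ∂(μ : Measure unitInterval) := fun n => by
    simp_rw [hD]
    refine (integral_tsum_of_summable_integral_norm (hDi n) ?_).symm
    refine Summable.of_nonneg_of_le (fun i => integral_nonneg fun x => norm_nonneg _)
      (fun i => ?_) summable_half_pow
    simp_rw [Real.norm_of_nonneg (hD0 n i _)]
    exact hIle n i
  simp_rw [hswap]
  rw [← tsum_zero (β := ℕ) (α := ℝ)]
  refine tendsto_tsum_of_dominated_convergence summable_half_pow (fun i => ?_)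
    (Eventually.of_forall fun n i => ?_)
  · have h1 := tendsto_integral_abs_birkhoffAverage hf (G := fun y => (Ψ i y : ℝ))
      (continuous_subtype_val.comp (Ψ i).continuous).measurable (C := 1)
      (fun x => abs_le.2 ⟨by linarith [(Ψ i x).2.1], (Ψ i x).2.2⟩)
    have h2 := ((tendsto_add_atTop_iff_nat 1).2 h1).const_mul ((1 / 2 : ℝ) ^ (i + 1))
    rw [mul_zero] at h2
    simpa only [D, integral_const_mul] using h2
  · rw [Real.norm_of_nonneg (integral_nonneg fun x => hD0 n i x)]
    exact hIle n i

theorem continuous_weakDist_empirical_right (f : Maps) (μ : Measures) (n : ℕ) :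
    Continuous fun x => weakDist Ψ (empirical f x n) μ := by
  refine continuous_weakDist_of_continuous Ψ _ μ fun i => ?_
  simp_rw [integral_empirical]
  exact continuous_const.mul (continuous_finsetSum _ fun j _ =>
    continuous_subtype_val.comp ((Ψ i).continuous.comp (f.continuous.iterate j)))

/-- Let `U` be the `δ/2`-ball around a point of the support. If no segment were suitable, almost
every point of `U` returning to `U` after `n + 1` steps would have its empirical measure at distance
at least `δ` from `μ`. By Markov's inequality the measure of such points tends to zero,
contradicting recurrence. -/
theorem isClosable_of_ergodic (hf : Ergodic f (μ : Measure unitInterval))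
    (hinj : ∀ᵐ x ∂(μ : Measure unitInterval), ∀ i j, f^[i] x = f^[j] x → i = j) :
    IsClosable Ψ f μ := by
  intro δ hδ
  obtain ⟨z, -, hz⟩ := exists_mem_forall_mem_nhdsWithin_pos_measure
    (μ := (μ : Measure unitInterval)) (s := univ) (by simp)
  have hzU : Metric.ball z (δ / 2) ∈ 𝓝[univ] z := by
    rw [nhdsWithin_univ]; exact Metric.ball_mem_nhds z (by positivity)
  have hUpos := ENNReal.toReal_pos (hz _ hzU).ne' (measure_ne_top _ _)
  by_contra hcon
  refine not_tendsto_measureReal_inter_preimage hf Metric.isOpen_ball.measurableSet hUpos ?_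
  let B : ℕ → Set unitInterval := fun n => {x | δ ≤ weakDist Ψ (empirical f x n) μ}
  have hBtend : Tendsto (fun n => (μ : Measure unitInterval).real (B n)) atTop (𝓝 0) := by
    refine squeeze_zero (fun n => measureReal_nonneg) (fun n => ?_)
      (by simpa using (tendsto_integral_weakDist_empirical Ψ hf).const_mul δ⁻¹)
    rw [inv_mul_eq_div, le_div_iff₀ hδ, mul_comm]
    exact mul_meas_ge_le_integral_of_nonneg (Eventually.of_forall fun x => weakDist_nonneg Ψ _ _)
      ((continuous_weakDist_empirical_right Ψ f μ n).integrable_of_hasCompactSupport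
        (HasCompactSupport.of_compactSpace _)) δ
  rw [← tendsto_add_atTop_iff_nat 1]
  refine squeeze_zero (fun n => measureReal_nonneg) (fun n => ?_) hBtend
  refine ENNReal.toReal_mono (measure_ne_top _ _) (measure_mono_ae ?_)
  filter_upwards [hinj] with x hx hxU
  have h1 := Metric.mem_ball.1 hxU.1
  have h2 := Metric.mem_ball.1 hxU.2
  refine not_lt.1 fun hlt => hcon ⟨x, n, fun i _ j _ h => hx i j h, ?_, hlt⟩
  linarith [dist_triangle_right x (f^[n + 1] x) z]

theorem IsBernoulli.isClosable (hm : 2 ≤ m) (h : IsBernoulli f m μ) : IsClosable Ψ f μ :=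
  isClosable_of_ergodic Ψ h.ergodic (h.ae_injective hm)

end IntervalMaps

namespace IntervalMaps

/-! ### Entropy of partitions -/

/-- Gibbs' inequality, from `log t ≤ t - 1` at `t = q / p`. It lets any weights `q` of total at most
one bound an entropy from above. -/
theorem sum_negMulLog_le {W : Type*} [Fintype W] {p q : W → ℝ} (hp : ∀ w, 0 ≤ p w)
    (hp1 : ∑ w, p w = 1) (hq : ∀ w, 0 ≤ q w) (hq1 : ∑ w, q w ≤ 1)
    (hpq : ∀ w, p w ≠ 0 → 0 < q w) :
    ∑ w, Real.negMulLog (p w) ≤ ∑ w, p w * -Real.log (q w) := by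
  have h : ∀ w, Real.negMulLog (p w) ≤ p w * -Real.log (q w) + (q w - p w) := by
    intro w
    by_cases h0 : p w = 0
    · simpa [h0] using hq w
    · have hp0 : 0 < p w := lt_of_le_of_ne (hp w) (Ne.symm h0)
      have h1 := Real.log_le_sub_one_of_pos (div_pos (hpq w h0) hp0)
      rw [Real.log_div (hpq w h0).ne' h0] at h1
      have h2 := mul_le_mul_of_nonneg_left h1 (hp w)
      rw [mul_sub, mul_sub, mul_div_cancel₀ _ h0] at h2
      rw [Real.negMulLog]
      linarith
  calc ∑ w, Real.negMulLog (p w) ≤ ∑ w, (p w * -Real.log (q w) + (q w - p w)) :=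
        Finset.sum_le_sum fun w _ => h w
    _ = ∑ w, p w * -Real.log (q w) + (∑ w, q w - ∑ w, p w) := by
        rw [Finset.sum_add_distrib, Finset.sum_sub_distrib]
    _ ≤ _ := by linarith

/-- The first `n` labels along the orbit of `x`. -/
def word (f : Maps) {k : ℕ} (ξ : unitInterval → Fin k) (n : ℕ) (x : unitInterval) : Fin n → Fin k :=
  fun j => ξ (f^[(j : ℕ)] x)

theorem measurable_word (f : Maps) {k : ℕ} {ξ : unitInterval → Fin k} (hξ : Measurable ξ) (n : ℕ) :
    Measurable (word f ξ n) :=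
  measurable_pi_lambda _ fun j => hξ.comp (f.continuous.iterate j).measurable

theorem setOf_word_eq (f : Maps) {k : ℕ} (ξ : unitInterval → Fin k) (n : ℕ) (w : Fin n → Fin k) :
    {x | ∀ j : Fin n, ξ (f^[(j : ℕ)] x) = w j} = word f ξ n ⁻¹' {w} := by
  ext x
  simp [word, funext_iff]

theorem integral_comp_word (f : Maps) (μ : Measures) {k : ℕ} {ξ : unitInterval → Fin k}
    (hξ : Measurable ξ) (n : ℕ) (g : (Fin n → Fin k) → ℝ) :
    ∫ x, g (word f ξ n x) ∂(μ : Measure unitInterval) =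
      ∑ w, (μ : Measure unitInterval).real {x | ∀ j : Fin n, ξ (f^[(j : ℕ)] x) = w j} * g w := by
  have hw := measurable_word f hξ n
  have : IsProbabilityMeasure ((μ : Measure unitInterval).map (word f ξ n)) :=
    Measure.isProbabilityMeasure_map hw.aemeasurable
  rw [← integral_map hw.aemeasurable (Measurable.of_discrete.aestronglyMeasurable),
    integral_fintype Integrable.of_finite]
  refine Finset.sum_congr rfl fun w _ => ?_
  rw [map_measureReal_apply hw (measurableSet_singleton w), setOf_word_eq, smul_eq_mul]

theorem partitionEntropy_le (f : Maps) (μ : Measures) {k : ℕ} {ξ : unitInterval → Fin k}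
    (hξ : Measurable ξ) (n : ℕ) {q : (Fin n → Fin k) → ℝ} (hq : ∀ w, 0 ≤ q w)
    (hq1 : ∑ w, q w ≤ 1)
    (hpq : ∀ w, (μ : Measure unitInterval).real {x | ∀ j : Fin n, ξ (f^[(j : ℕ)] x) = w j} ≠ 0 →
      0 < q w) :
    partitionEntropy f μ ξ n ≤ ∫ x, -Real.log (q (word f ξ n x)) ∂(μ : Measure unitInterval) := by
  rw [integral_comp_word f μ hξ n fun w => -Real.log (q w)]
  refine sum_negMulLog_le (fun w => measureReal_nonneg) ?_ hq hq1 hpq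
  have := integral_comp_word f μ hξ n fun _ => 1
  simpa using this.symm

/-- Along the orbit at most `p + 1` words occur for each `n`, so the partition entropies are bounded
by `log (p + 1)` uniformly in `n`. -/
theorem entropy_eq_zero_of_periodic {f : Maps} {μ : Measures} (hμ : μ ∈ periodicMeasures f) :
    entropy f μ = 0 := by
  obtain ⟨x, p, -, rfl⟩ := hμ
  classical
  refine le_antisymm (iSup_le fun k => iSup_le fun ξ => iSup_le fun hξ => ?_) bot_le
  have hH : ∀ n, partitionEntropy f (empirical f x p) ξ n ≤ Real.log (p + 1) := by
    intro n
    let S : Finset (Fin n → Fin k) := (Finset.range (p + 1)).image fun j => word f ξ n (f^[j] x)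
    have hmem : ∀ᵐ y ∂(empirical f x p : Measure unitInterval), word f ξ n y ∈ S := by
      have hm : MeasurableSet (word f ξ n ⁻¹' (S : Set (Fin n → Fin k)))  :=
        measurable_word f hξ n S.measurableSet
      change ∀ᵐ y ∂(((p + 1 : ℕ) : ENNReal)⁻¹ •
        ∑ j ∈ Finset.range (p + 1), Measure.dirac (f^[j] x)), word f ξ n y ∈ S
      refine Measure.ae_smul_measure ?_ _
      rw [← Measure.sum_coe_finset, Measure.ae_sum_iff]
      rintro ⟨j, hj⟩
      rw [ae_dirac_iff (p := fun y => word f ξ n y ∈ S) hm]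
      exact Finset.mem_image_of_mem _ hj
    have hcard : (S.card : ℝ) ≤ p + 1 := by
      exact_mod_cast Finset.card_image_le.trans (by simp)
    refine (partitionEntropy_le f _ hξ n (q := fun w => if w ∈ S then ((p : ℝ) + 1)⁻¹ else 0)
      (fun w => by positivity) ?_ fun w hw => ?_).trans ?_
    · rw [← Finset.sum_filter, Finset.sum_const, nsmul_eq_mul, ← div_eq_mul_inv,
        div_le_one (by positivity)]
      simpa using hcard
    · rw [if_pos]
      · positivity
      · by_contra hwS
        refine hw ?_
        rw [measureReal_def, measure_eq_zero_iff_ae_notMem.2, ENNReal.toReal_zero]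
        filter_upwards [hmem] with y hy hyw
        exact hwS ((show word f ξ n y = w from funext hyw) ▸ hy)
    · rw [integral_congr_ae (g := fun _ => Real.log (p + 1)) (by
        filter_upwards [hmem] with y hy
        rw [if_pos hy, Real.log_inv, neg_neg])]
      simp
  have hlim : Tendsto (fun n : ℕ => ENNReal.ofReal (Real.log (p + 1) / n)) atTop (𝓝 0) := by
    rw [← ENNReal.ofReal_zero]
    exact ENNReal.tendsto_ofReal (tendsto_const_div_atTop_nhds_zero_nat _)
  refine (limsup_le_limsup (Eventually.of_forall fun n => ?_)).trans hlim.limsup_eq.le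
  exact ENNReal.ofReal_le_ofReal (by gcongr; exact hH n)

/-! ### Entropy of Bernoulli measures -/

/-- The sequence that starts with the word `u`. -/
def extend {m N : ℕ} [NeZero m] (u : Fin N → Fin m) : ℕ → Fin m :=
  fun i => if h : i < N then u ⟨i, h⟩ else 0

theorem measurable_of_dependsOn {m : ℕ} [NeZero m] {k N : ℕ} {c : (ℕ → Fin m) → Fin k}
    (hc : ∀ ω ω', (∀ i < N, ω i = ω' i) → c ω = c ω') : Measurable c := by
  have : c = (fun u : Fin N → Fin m => c (extend u)) ∘ fun ω i => ω i :=
    funext fun ω => hc _ _ fun i hi => by simp [extend, hi]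
  rw [this]
  exact Measurable.of_discrete.comp (measurable_pi_lambda _ fun i => measurable_pi_apply _)

/-- Approximate each atom by a cylinder set `t b` and let `c` choose a label among the `b` with `ω ∈
t b`. Off the symmetric differences exactly one label is available, namely `ξ ω`. The choice depends
only on the set of available labels, so `c` depends on finitely many coordinates. -/
theorem exists_cylinder_approx {m : ℕ} [NeZero m] {k : ℕ} {ξ : (ℕ → Fin m) → Fin k}
    (hξ : Measurable ξ) {η : ℝ} (hη : 0 < η) :
    ∃ (N : ℕ) (c : (ℕ → Fin m) → Fin k), Measurable c ∧
      (∀ ω ω', (∀ i < N, ω i = ω' i) → c ω = c ω') ∧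
      (uniformBernoulli m).real {ω | ξ ω ≠ c ω} < η := by
  classical
  have : Nonempty (Fin k) := ⟨ξ fun _ => 0⟩
  have hk : (0 : ℝ) < k := by exact_mod_cast Fin.pos_iff_nonempty.2 this
  have happ : ∀ b : Fin k, ∃ t ∈ measurableCylinders (fun _ : ℕ => Fin m),
      uniformBernoulli m (symmDiff t (ξ ⁻¹' {b})) < ENNReal.ofReal (η / k) := fun b =>
    exists_measure_symmDiff_lt_of_generateFrom_isSetRing isSetRing_measurableCylinders
      ⟨{univ}, countable_singleton _, by
        simpa using univ_mem_measurableCylinders (fun _ : ℕ => Fin m), by simp⟩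
      generateFrom_measurableCylinders.symm (hξ (measurableSet_singleton b))
      (by rw [ENNReal.ofReal_pos]; positivity)
  choose t ht hta using happ
  have hdep : ∀ b, ∃ N : ℕ, ∀ ω ω' : ℕ → Fin m, (∀ i < N, ω i = ω' i) → (ω ∈ t b ↔ ω' ∈ t b) := by
    intro b
    obtain ⟨s, S, -, hs⟩ := (mem_measurableCylinders _).1 (ht b)
    refine ⟨s.sup id + 1, fun ω ω' h => ?_⟩
    rw [hs, mem_cylinder, mem_cylinder]
    have : s.restrict ω = s.restrict ω' := funext fun i =>
      h i (Nat.lt_succ_of_le (Finset.le_sup (f := id) i.2))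
    rw [this]
  choose N hN using hdep
  let pick : (Fin k → Prop) → Fin k := fun P =>
    if h : ∃ b, P b then h.choose else Classical.arbitrary _
  have hpick : ∀ P : Fin k → Prop, (∃ b, P b) → P (pick P) := fun P h => by
    simp only [pick, dif_pos h]
    exact h.choose_spec
  let c : (ℕ → Fin m) → Fin k := fun ω => pick fun b => ω ∈ t b
  have hcdep : ∀ ω ω', (∀ i < Finset.univ.sup N, ω i = ω' i) → c ω = c ω' := by
    intro ω ω' h
    have : (fun b => ω ∈ t b) = fun b => ω' ∈ t b := funext fun b => propext
      (hN b ω ω' fun i hi => h i (hi.trans_le (Finset.le_sup (Finset.mem_univ b))))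
    simp only [c, this]
  refine ⟨Finset.univ.sup N, c, measurable_of_dependsOn hcdep, hcdep, ?_⟩
  have hsub : {ω | ξ ω ≠ c ω} ⊆ ⋃ b, symmDiff (t b) (ξ ⁻¹' {b}) := by
    intro ω hω
    by_contra hnot
    have hiff : ∀ b, ω ∈ t b ↔ ξ ω = b := fun b => by
      have : ω ∉ symmDiff (t b) (ξ ⁻¹' {b}) := fun h => hnot (mem_iUnion.2 ⟨b, h⟩)
      rw [Set.mem_symmDiff, mem_preimage, mem_singleton_iff] at this
      tauto
    exact hω ((hiff _).1 (hpick (fun b => ω ∈ t b) ⟨ξ ω, (hiff _).2 rfl⟩))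
  calc (uniformBernoulli m).real {ω | ξ ω ≠ c ω}
      ≤ (uniformBernoulli m).real (⋃ b, symmDiff (t b) (ξ ⁻¹' {b})) := measureReal_mono hsub
    _ ≤ ∑ b, (uniformBernoulli m).real (symmDiff (t b) (ξ ⁻¹' {b})) :=
        measureReal_iUnion_fintype_le _
    _ < ∑ _b : Fin k, η / k := by
        refine Finset.sum_lt_sum_of_nonempty Finset.univ_nonempty fun b _ => ?_
        rw [measureReal_def]
        exact (ENNReal.lt_ofReal_iff_toReal_lt (measure_ne_top _ _)).1 (hta b)
    _ = η := by simp; field_simp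

theorem neg_log_smoothing_le {k : ℕ} {δ : ℝ} (hδ0 : 0 < δ) (hδ1 : δ < 1) (a b : Fin k) :
    -Real.log ((if b = a then 1 - δ else 0) + δ / k) ≤
      -Real.log (1 - δ) + if b = a then 0 else Real.log (k / δ) := by
  have hk : (0 : ℝ) < k := by exact_mod_cast Fin.pos a
  split_ifs
  · rw [add_zero, neg_le_neg_iff]
    have : 0 < δ / k := by positivity
    exact Real.log_le_log (by linarith) (by linarith)
  · rw [zero_add, ← Real.log_inv, inv_div]
    have : Real.log (1 - δ) ≤ 0 := Real.log_nonpos (by linarith) (by linarith)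
    linarith

variable {m : ℕ} [NeZero m] {f : Maps} {μ : Measures}

/-- Gibbs' inequality with a noisy coding distribution. The first `n + N` symbols determine the
approximating labels at `n` times and cost `(n + N) log m`; each label then costs `-log (1 - δ)`,
plus `log (k / δ)` where the approximation is wrong. -/
theorem partitionEntropy_le_of_coding (hμ : MeasurePreserving f (μ : Measure unitInterval) μ)
    {φ : unitInterval → ℕ → Fin m} (hφ : Measurable φ)
    (hφf : ∀ᵐ x ∂(μ : Measure unitInterval), ∀ n, φ (f^[n] x) = shift^[n] (φ x)) {k : ℕ}
    {ξ : unitInterval → Fin k} (hξ : Measurable ξ) {N : ℕ} {c : (ℕ → Fin m) → Fin k}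
    (hc : Measurable c) (hcN : ∀ ω ω', (∀ i < N, ω i = ω' i) → c ω = c ω') {δ : ℝ} (hδ0 : 0 < δ)
    (hδ1 : δ < 1) (n : ℕ) :
    partitionEntropy f μ ξ n ≤ (n + N) * Real.log m + n * (-Real.log (1 - δ) +
      Real.log (k / δ) * (μ : Measure unitInterval).real {x | ξ x ≠ c (φ x)}) := by
  have hk : (0 : ℝ) < k := by exact_mod_cast Fin.pos (ξ 0)
  have hm : (0 : ℝ) < m := by exact_mod_cast Nat.pos_of_ne_zero (NeZero.ne m)
  let r : Fin k → Fin k → ℝ := fun b a => (if b = a then 1 - δ else 0) + δ / k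
  have hr : ∀ b a, 0 < r b a := fun b a => by
    have h1 : 0 < δ / k := by positivity
    have h2 : (0 : ℝ) ≤ if b = a then 1 - δ else 0 := by split_ifs <;> linarith
    exact add_pos_of_nonneg_of_pos h2 h1
  have hr1 : ∀ a, ∑ b, r b a = 1 := fun a => by
    simp only [r, Finset.sum_add_distrib, Finset.sum_ite_eq', Finset.mem_univ, if_true,
      Finset.sum_const, Finset.card_univ, Fintype.card_fin, nsmul_eq_mul]
    field_simp
    ring
  let v : (Fin (n + N) → Fin m) → Fin n → Fin k := fun u j => c (shift^[(j : ℕ)] (extend u))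
  -- The law of a random word: draw `u` uniformly, write the labels `v u`, and replace each
  -- independently, with probability `δ`, by a uniform label.
  let q : (Fin n → Fin k) → ℝ := fun w =>
    ∑ u : Fin (n + N) → Fin m, ((m : ℝ) ^ (n + N))⁻¹ * ∏ j, r (w j) (v u j)
  have hterm : ∀ (w : Fin n → Fin k) u, 0 < ((m : ℝ) ^ (n + N))⁻¹ * ∏ j, r (w j) (v u j) := fun w u =>
    mul_pos (by positivity) (Finset.prod_pos fun j _ => hr _ _)
  have hqpos : ∀ w, 0 < q w := fun w =>
    Finset.sum_pos (fun u _ => hterm w u) Finset.univ_nonempty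
  have hq1 : ∑ w, q w = 1 := by
    simp only [q]
    rw [Finset.sum_comm]
    have : ∀ u, ∑ w : Fin n → Fin k, ((m : ℝ) ^ (n + N))⁻¹ * ∏ j, r (w j) (v u j) =
        ((m : ℝ) ^ (n + N))⁻¹ := fun u => by
      rw [← Finset.mul_sum]
      have h1 := Finset.prod_univ_sum (fun _ : Fin n => (Finset.univ : Finset (Fin k)))
        fun j b => r b (v u j)
      simp only [hr1, Finset.prod_const_one, Fintype.piFinset_univ] at h1
      rw [← h1, mul_one]
    simp only [this, Finset.sum_const, Finset.card_univ, Fintype.card_fun, Fintype.card_fin,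
      nsmul_eq_mul]
    push_cast
    field_simp
  refine (partitionEntropy_le f μ hξ n (fun w => (hqpos w).le) hq1.le fun w _ => hqpos w).trans ?_
  set A := {x | ξ x ≠ c (φ x)} with hA
  have hAm : MeasurableSet A := (measurableSet_eq_fun hξ (hc.comp hφ)).compl
  let L : unitInterval → ℝ := fun x => -Real.log (1 - δ) + Real.log (k / δ) * A.indicator 1 x
  have hLm : Measurable L :=
    measurable_const.add (measurable_const.mul (measurable_one.indicator hAm))
  have hAi : Integrable (fun x => A.indicator (1 : unitInterval → ℝ) x)
      (μ : Measure unitInterval) := (integrable_const (1 : ℝ)).indicator hAm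
  have hLi : Integrable L (μ : Measure unitInterval) :=
    (integrable_const _).add (hAi.const_mul _)
  have hLj : ∀ j, Integrable (fun x => L (f^[j] x)) (μ : Measure unitInterval) := fun j =>
    (hμ.iterate j).integrable_comp_of_integrable hLi
  have hLint : ∀ j, ∫ x, L (f^[j] x) ∂(μ : Measure unitInterval) = -Real.log (1 - δ) +
      Real.log (k / δ) * (μ : Measure unitInterval).real A := fun j => by
    have h1 : ∫ x, L x ∂(μ : Measure unitInterval) = -Real.log (1 - δ) +
        Real.log (k / δ) * (μ : Measure unitInterval).real A := by
      simp only [L]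
      rw [integral_add (integrable_const _) (hAi.const_mul _),
        integral_const_mul, integral_indicator_one hAm]
      simp
    rw [← h1]
    conv_rhs => rw [← (hμ.iterate j).map_eq]
    rw [integral_map (hμ.iterate j).measurable.aemeasurable hLm.aestronglyMeasurable]
  have hbound : ∀ᵐ x ∂(μ : Measure unitInterval), -Real.log (q (word f ξ n x)) ≤
      (n + N) * Real.log m + ∑ j : Fin n, L (f^[(j : ℕ)] x) := by
    filter_upwards [hφf] with x hx
    let u : Fin (n + N) → Fin m := fun i => φ x i
    have hu : ∀ j : Fin n, v u j = c (φ (f^[(j : ℕ)] x)) := fun j => by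
      rw [hx]
      refine hcN _ _ fun i hi => ?_
      rw [shift_iterate_apply, shift_iterate_apply, extend, dif_pos (by omega)]
    have h1 : ((m : ℝ) ^ (n + N))⁻¹ * ∏ j, r (word f ξ n x j) (v u j) ≤ q (word f ξ n x) :=
      Finset.single_le_sum (f := fun u => ((m : ℝ) ^ (n + N))⁻¹ *
        ∏ j, r (word f ξ n x j) (v u j)) (fun u _ => (hterm _ u).le) (Finset.mem_univ u)
    have h2 := Real.log_le_log (hterm _ u) h1
    rw [Real.log_mul (by positivity) (Finset.prod_pos fun j _ => hr _ _).ne', Real.log_inv,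
      Real.log_pow, Real.log_prod (fun j _ => (hr _ _).ne')] at h2
    have h3 : ∀ j : Fin n, -Real.log (r (word f ξ n x j) (v u j)) ≤ L (f^[(j : ℕ)] x) := by
      intro j
      refine (neg_log_smoothing_le hδ0 hδ1 _ _).trans (le_of_eq ?_)
      simp only [L, hu, word]
      congr 1
      by_cases h : ξ (f^[(j : ℕ)] x) = c (φ (f^[(j : ℕ)] x))
      · rw [if_pos h, indicator_of_notMem (fun h' : f^[(j : ℕ)] x ∈ A => h' h), mul_zero]
      · rw [if_neg h, indicator_of_mem (show f^[(j : ℕ)] x ∈ A from h)]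
        simp
    have h4 := Finset.sum_le_sum fun j (_ : j ∈ Finset.univ) => h3 j
    rw [Finset.sum_neg_distrib] at h4
    push_cast at h2
    linarith
  have hSi : Integrable (fun x => ∑ j : Fin n, L (f^[(j : ℕ)] x)) (μ : Measure unitInterval) :=
    integrable_finsetSum _ fun j _ => hLj j
  have hRi : Integrable (fun x => (n + N) * Real.log m + ∑ j : Fin n, L (f^[(j : ℕ)] x))
      (μ : Measure unitInterval) :=
    (integrable_const _).add hSi
  have hQi : Integrable (fun x => -Real.log (q (word f ξ n x))) (μ : Measure unitInterval) := by
    have h1 : Integrable (fun w => -Real.log (q w)) ((μ : Measure unitInterval).map (word f ξ n)) :=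
      Integrable.of_finite
    exact h1.comp_measurable (measurable_word f hξ n)
  refine (integral_mono_ae hQi hRi hbound).trans (le_of_eq ?_)
  rw [integral_add (integrable_const _) hSi,
    integral_finsetSum (f := fun (j : Fin n) x => L (f^[(j : ℕ)] x)) _ fun j _ => hLj j]
  simp only [hLint, integral_const, probReal_univ, one_smul, Finset.sum_const, Finset.card_univ,
    Fintype.card_fin, nsmul_eq_mul]

theorem IsBernoulli.entropy_le (h : IsBernoulli f m μ) :
    entropy f μ ≤ ENNReal.ofReal (Real.log m) := by
  obtain ⟨φ, ψ, hφ, hψ, hψφ, hφf⟩ := h.ae_coding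
  refine iSup_le fun k => iSup_le fun ξ => iSup_le fun hξ => ?_
  have hk : 1 ≤ k := Fin.pos (ξ 0)
  have hk' : (1 : ℝ) ≤ k := by exact_mod_cast hk
  refine ENNReal.le_of_forall_pos_le_add fun ε hε _ => ?_
  have hε' : (0 : ℝ) < ε := hε
  -- Chosen so that the smoothing cost `-log (1 - δ)` is exactly `ε / 2`; the cylinder approximation
  -- is then taken fine enough to spend at most the other half.
  set δ : ℝ := 1 - Real.exp (-(ε / 2)) with hδ
  have hδ1 : δ < 1 := by have := Real.exp_pos (-((ε : ℝ) / 2)); linarith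
  have hδ0 : 0 < δ := by
    have : Real.exp (-((ε : ℝ) / 2)) < 1 :=
      Real.exp_zero ▸ Real.exp_lt_exp.2 (by linarith)
    linarith
  have hδlog : -Real.log (1 - δ) = ε / 2 := by
    rw [hδ, sub_sub_cancel, Real.log_exp, neg_neg]
  have hK : 0 ≤ Real.log (k / δ) := Real.log_nonneg (by
    rw [le_div_iff₀ hδ0]; linarith)
  obtain ⟨N, c, hc, hcN, hcB⟩ := exists_cylinder_approx (hξ.comp hψ)
    (show 0 < (ε : ℝ) / (2 * (Real.log (k / δ) + 1)) by positivity)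
  have hA : (μ : Measure unitInterval).real {x | ξ x ≠ c (φ x)} ≤
      (uniformBernoulli m).real {ω | (ξ ∘ ψ) ω ≠ c ω} := by
    have hm : MeasurableSet {ω | (ξ ∘ ψ) ω ≠ c ω} := (measurableSet_eq_fun (hξ.comp hψ) hc).compl
    rw [← hφ.measureReal_preimage hm.nullMeasurableSet]
    refine ENNReal.toReal_mono (measure_ne_top _ _) (measure_mono_ae ?_)
    filter_upwards [hψφ] with x hx hxA
    change ξ (ψ (φ x)) ≠ c (φ x)
    rwa [hx]
  have herr : Real.log (k / δ) * (μ : Measure unitInterval).real {x | ξ x ≠ c (φ x)} ≤ ε / 2 := by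
    calc _ ≤ Real.log (k / δ) * (ε / (2 * (Real.log (k / δ) + 1))) :=
          mul_le_mul_of_nonneg_left (hA.trans hcB.le) hK
      _ ≤ (Real.log (k / δ) + 1) * (ε / (2 * (Real.log (k / δ) + 1))) := by gcongr; linarith
      _ = ε / 2 := by field_simp
  have hH : ∀ n : ℕ, 0 < n → partitionEntropy f μ ξ n / n ≤
      (Real.log m + ε) + N * Real.log m / n := by
    intro n hn
    have hn' : (0 : ℝ) < n := by exact_mod_cast hn
    have h1 := partitionEntropy_le_of_coding h.1 hφ.measurable hφf hξ hc hcN hδ0 hδ1 n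
    rw [hδlog] at h1
    have h2 : (n : ℝ) * (ε / 2 + Real.log (k / δ) *
        (μ : Measure unitInterval).real {x | ξ x ≠ c (φ x)}) ≤ n * ε := by
      gcongr; linarith
    rw [div_le_iff₀ hn', add_mul, div_mul_cancel₀ _ hn'.ne']
    linarith
  have hlim : Tendsto (fun n : ℕ => ENNReal.ofReal ((Real.log m + ε) + N * Real.log m / n)) atTop
      (𝓝 (ENNReal.ofReal (Real.log m + ε))) := by
    refine ENNReal.tendsto_ofReal ?_
    simpa using (tendsto_const_div_atTop_nhds_zero_nat (N * Real.log m)).const_add (Real.log m + ε)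
  calc limsup (fun n : ℕ => ENNReal.ofReal (partitionEntropy f μ ξ n / n)) atTop
      ≤ limsup (fun n : ℕ => ENNReal.ofReal ((Real.log m + ε) + N * Real.log m / n)) atTop := by
        refine limsup_le_limsup ?_
        filter_upwards [eventually_gt_atTop 0] with n hn using ENNReal.ofReal_le_ofReal (hH n hn)
    _ = ENNReal.ofReal (Real.log m + ε) := hlim.limsup_eq
    _ ≤ ENNReal.ofReal (Real.log m) + ENNReal.ofReal ε := ENNReal.ofReal_add_le
    _ = ENNReal.ofReal (Real.log m) + ε := by rw [ENNReal.ofReal_coe_nnreal]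

/-- The partition by the first symbol already suffices: all `m ^ n` words have equal probability. -/
theorem IsBernoulli.le_entropy (h : IsBernoulli f m μ) :
    ENNReal.ofReal (Real.log m) ≤ entropy f μ := by
  obtain ⟨φ, -, hφ, -, -, hφf⟩ := h.ae_coding
  have hm : (m : ℝ) ≠ 0 := by exact_mod_cast NeZero.ne m
  let ξ : unitInterval → Fin m := fun x => φ x 0
  have hξ : Measurable ξ := (measurable_pi_apply 0).comp hφ.measurable
  have hw : ∀ (n : ℕ) (w : Fin n → Fin m),
      (μ : Measure unitInterval).real {x | ∀ j : Fin n, ξ (f^[(j : ℕ)] x) = w j} =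
        ((m : ℝ) ^ n)⁻¹ := by
    intro n w
    have hms : MeasurableSet {ω : ℕ → Fin m | ∀ j : Fin n, ω j = w j} := by
      simp_rw [ofPred_forall]
      exact MeasurableSet.iInter fun j =>
        measurable_pi_apply (X := fun _ : ℕ => Fin m) (j : ℕ) (measurableSet_singleton (w j))
    have h1 : {x | ∀ j : Fin n, ξ (f^[(j : ℕ)] x) = w j} =ᵐ[(μ : Measure unitInterval)]
        φ ⁻¹' {ω | ∀ j : Fin n, ω j = w j} := by
      filter_upwards [hφf] with x hx
      change (∀ j : Fin n, φ (f^[(j : ℕ)] x) 0 = w j) = ∀ j : Fin n, φ x j = w j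
      simp only [hx, shift_iterate_apply, zero_add]
    rw [measureReal_congr h1, hφ.measureReal_preimage hms.nullMeasurableSet, measureReal_def,
      uniformBernoulli_cylinder]
    simp
  have hH : ∀ n, partitionEntropy f μ ξ n = n * Real.log m := by
    intro n
    simp only [partitionEntropy, hw, Finset.sum_const, Finset.card_univ, Fintype.card_fun,
      Fintype.card_fin, nsmul_eq_mul, Real.negMulLog, Real.log_inv, Real.log_pow]
    push_cast
    field_simp
  refine le_iSup_of_le m (le_iSup_of_le ξ (le_iSup_of_le hξ (le_of_eq ?_)))
  refine (Tendsto.limsup_eq ?_).symm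
  refine tendsto_const_nhds.congr' ?_
  filter_upwards [eventually_gt_atTop 0] with n hn
  have hn' : (n : ℝ) ≠ 0 := by exact_mod_cast hn.ne'
  rw [hH, mul_div_cancel_left₀ _ hn']

theorem IsBernoulli.entropy_eq (h : IsBernoulli f m μ) :
    entropy f μ = ENNReal.ofReal (Real.log m) :=
  le_antisymm h.entropy_le h.le_entropy

end IntervalMaps

namespace IntervalMaps

/-! ### Typical maps have the required properties -/

variable {Ψ : ℕ → Maps} {f : Maps}

variable (Ψ f) in
/-- Attracting balls and horseshoes that can be created by arbitrarily small perturbations of `f`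
are already there. -/
def IsRich : Prop :=
  HasAttractors Ψ f ∧ ∀ m, ∀ U ∈ TopologicalSpace.countableBasis unitInterval,
    f ∈ closure (horseshoes m U) → f ∈ horseshoes m U

theorem isTypical_isRich (Ψ : ℕ → Maps) : IsTypical (IsRich Ψ) := by
  have : Countable (TopologicalSpace.countableBasis unitInterval) :=
    (TopologicalSpace.countable_countableBasis unitInterval).to_subtype
  obtain ⟨G, hG, hd, h⟩ := isTypical_of_forall_mem_closure
    (ι := (ℕ × ℕ) ⊕ (ℕ × TopologicalSpace.countableBasis unitInterval))
    (Sum.elim (fun q => attracting Ψ (TopologicalSpace.denseSeq Measures q.1)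
      (1 / ((q.2 : ℝ) + 1))) fun q => horseshoes q.1 q.2)
    (by rintro (q | q)
        · exact isOpen_attracting Ψ _ _
        · exact isOpen_horseshoes _ _)
  exact ⟨G, hG, hd, fun f hf => ⟨fun j k => h f hf (Sum.inl (j, k)),
    fun m U hU => h f hf (Sum.inr (m, ⟨U, hU⟩))⟩⟩

theorem diracProba_mem_periodicMeasures {x : unitInterval} (hx : f x = x) :
    diracProba x ∈ periodicMeasures f := by
  have h : diracProba x = empirical f x 0 := by
    apply Subtype.ext
    change Measure.dirac x =
      ((0 + 1 : ℕ) : ENNReal)⁻¹ • ∑ j ∈ Finset.range (0 + 1), Measure.dirac (f^[j] x)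
    simp
  rw [h]
  exact empirical_mem_periodicMeasures hx

theorem exists_fixedPoint (f : Maps) : ∃ x, f x = x := by
  obtain ⟨x, -, hx⟩ := exists_mem_Icc_isFixedPt_of_mapsTo (f := f) (a := (0 : unitInterval))
    (b := 1) f.continuous.continuousOn zero_le_one fun _ _ =>
      ⟨unitInterval.nonneg', unitInterval.le_one'⟩
  exact ⟨x, hx⟩

namespace IsRich

theorem periodicMeasures_subset (hf : IsRich Ψ f) : periodicMeasures f ⊆ pseudoPhysical Ψ f :=
  fun _ hμ => mem_pseudoPhysical_of_closable hf.1 (closable_of_periodic hμ)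

theorem exists_bernoulli_tendsto (hf : IsRich Ψ f) {x : unitInterval} (hx : f x = x) {m : ℕ}
    [NeZero m] (hm : 2 ≤ m) :
    ∃ μ : ℕ → Measures, (∀ n, IsBernoulli f m (μ n)) ∧ Tendsto μ atTop (𝓝 (diracProba x)) := by
  have hU : ∀ n : ℕ, ∃ U ∈ TopologicalSpace.countableBasis unitInterval, x ∈ U ∧
      U ⊆ Metric.ball x (1 / ((n : ℝ) + 1)) := fun n =>
    (TopologicalSpace.isBasis_countableBasis unitInterval).exists_subset_of_mem_open
      (Metric.mem_ball_self (by positivity)) Metric.isOpen_ball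
  choose U hUb hxU hUsub using hU
  have hμ : ∀ n, ∃ μ : Measures, IsBernoulli f m μ ∧
      ∀ᵐ x ∂(μ : Measure unitInterval), x ∈ U n := fun n =>
    exists_isBernoulli_of_mem_horseshoes hm (hf.2 m _ (hUb n) (mem_closure_horseshoes hx m
      (((TopologicalSpace.isBasis_countableBasis unitInterval).isOpen (hUb n)).mem_nhds (hxU n))))
  choose μ hμB hμU using hμ
  refine ⟨μ, hμB, tendsto_diracProba (fun V hV => ?_) hμU⟩
  obtain ⟨ε, hε, hεV⟩ := Metric.mem_nhds_iff.1 hV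
  filter_upwards [(tendsto_one_div_add_atTop_nhds_zero_nat (𝕜 := ℝ)).eventually_lt_const hε]
    with n hn
  exact (hUsub n).trans ((Metric.ball_subset_ball hn.le).trans hεV)

theorem bernoulli_mem_pseudoPhysical (hf : IsRich Ψ f) {m : ℕ} [NeZero m] (hm : 2 ≤ m)
    {μ : Measures} (hμ : IsBernoulli f m μ) : μ ∈ pseudoPhysical Ψ f :=
  mem_pseudoPhysical_of_closable hf.1 (hμ.isClosable Ψ hm)

theorem exists_periodic_tendsto (hΨ : DenseRange Ψ) (hf : IsRich Ψ f) {m : ℕ} [NeZero m]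
    (hm : 2 ≤ m) {μ : Measures} (hμ : IsBernoulli f m μ) :
    ∃ ν : ℕ → Measures, (∀ n, ν n ∈ periodicMeasures f ∩ pseudoPhysical Ψ f) ∧
      Tendsto ν atTop (𝓝 μ) :=
  exists_seq_tendsto_of_weakDist hΨ fun _ hε => by
    obtain ⟨ν, hν, hd⟩ := exists_periodic_of_closable hf.1 (hμ.isClosable Ψ hm) hε
    exact ⟨ν, ⟨hν, hf.periodicMeasures_subset hν⟩, hd⟩

/-- Stated for a general `S` so as to apply both to the invariant and to the pseudo-physical
measures. -/
theorem not_upperSemicontinuousOn (hf : IsRich Ψ f) {S : Set Measures}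
    (hper : ∀ x, f x = x → diracProba x ∈ S) (hber : ∀ μ, IsBernoulli f 2 μ → μ ∈ S) :
    ¬ UpperSemicontinuousOn (entropy f) S := by
  intro h
  obtain ⟨x, hx⟩ := exists_fixedPoint f
  obtain ⟨μ, hμ, hlim⟩ := hf.exists_bernoulli_tendsto hx (le_refl 2)
  have hpos : entropy f (diracProba x) < ENNReal.ofReal (Real.log (2 : ℕ)) := by
    rw [entropy_eq_zero_of_periodic (diracProba_mem_periodicMeasures hx), ENNReal.ofReal_pos]
    exact Real.log_pos (by norm_num)
  have hev := h _ (hper x hx) _ hpos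
  obtain ⟨n, hn⟩ := ((tendsto_nhdsWithin_iff.2
    ⟨hlim, Eventually.of_forall fun n => hber _ (hμ n)⟩).eventually hev).exists
  rw [(hμ n).entropy_eq] at hn
  exact lt_irrefl _ hn

theorem not_lowerSemicontinuousOn (hΨ : DenseRange Ψ) (hf : IsRich Ψ f) {S : Set Measures}
    (hper : periodicMeasures f ⊆ S) (hber : ∀ μ, IsBernoulli f 2 μ → μ ∈ S) :
    ¬ LowerSemicontinuousOn (entropy f) S := by
  intro h
  obtain ⟨x, hx⟩ := exists_fixedPoint f
  obtain ⟨μ, hμ, -⟩ := hf.exists_bernoulli_tendsto hx (le_refl 2)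
  obtain ⟨ν, hν, hlim⟩ := hf.exists_periodic_tendsto hΨ (le_refl 2) (hμ 0)
  have hpos : 0 < entropy f (μ 0) := by
    rw [(hμ 0).entropy_eq, ENNReal.ofReal_pos]
    exact Real.log_pos (by norm_num)
  have hev := h _ (hber _ (hμ 0)) _ hpos
  obtain ⟨n, hn⟩ := ((tendsto_nhdsWithin_iff.2
    ⟨hlim, Eventually.of_forall fun n => hper (hν n).1⟩).eventually hev).exists
  rw [entropy_eq_zero_of_periodic (hν n).1] at hn
  exact lt_irrefl _ hn

end IsRich

end IntervalMaps

end
theorem mainTheorem6 (Ψ : ℕ → IntervalMaps.Maps) (hΨ : DenseRange Ψ) :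
    IntervalMaps.IsTypical fun f =>
      (¬ UpperSemicontinuousOn (IntervalMaps.entropy f) (IntervalMaps.invariantMeasures f) ∧
        ¬ LowerSemicontinuousOn (IntervalMaps.entropy f) (IntervalMaps.invariantMeasures f)) ∧
      (IntervalMaps.pseudoPhysical Ψ f ⊆ IntervalMaps.invariantMeasures f ∧
        ¬ UpperSemicontinuousOn (IntervalMaps.entropy f) (IntervalMaps.pseudoPhysical Ψ f) ∧
        ¬ LowerSemicontinuousOn (IntervalMaps.entropy f) (IntervalMaps.pseudoPhysical Ψ f)) ∧
      (∀ x : unitInterval, f x = x →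
        diracProba x ∈ IntervalMaps.pseudoPhysical Ψ f ∧
        ∀ (m : ℕ) [NeZero m], 2 ≤ m →
          ∃ μ : ℕ → IntervalMaps.Measures,
            (∀ n, IntervalMaps.IsBernoulli f m (μ n)) ∧
              Tendsto μ atTop (𝓝 (diracProba x))) ∧
      (∀ (m : ℕ) [NeZero m], 2 ≤ m →
        ∀ μ : IntervalMaps.Measures, IntervalMaps.IsBernoulli f m μ →
          IntervalMaps.entropy f μ = ENNReal.ofReal (Real.log m) ∧
          μ ∈ IntervalMaps.pseudoPhysical Ψ f ∧
          ∃ ν : ℕ → IntervalMaps.Measures,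
            (∀ n, ν n ∈ IntervalMaps.periodicMeasures f ∩ IntervalMaps.pseudoPhysical Ψ f) ∧
              Tendsto ν atTop (𝓝 μ)) := by
  obtain ⟨G, hG, hd, h⟩ := IntervalMaps.isTypical_isRich Ψ
  refine ⟨G, hG, hd, fun f hfG => ?_⟩
  have hf := h f hfG
  have hsub := IntervalMaps.pseudoPhysical_subset hΨ f
  have hper := hf.periodicMeasures_subset
  have hfix : ∀ x, f x = x → diracProba x ∈ IntervalMaps.pseudoPhysical Ψ f := fun x hx =>
    hper (IntervalMaps.diracProba_mem_periodicMeasures hx)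
  have hber : ∀ μ, IntervalMaps.IsBernoulli f 2 μ → μ ∈ IntervalMaps.pseudoPhysical Ψ f :=
    fun μ hμ => hf.bernoulli_mem_pseudoPhysical le_rfl hμ
  exact ⟨⟨hf.not_upperSemicontinuousOn (fun x hx => hsub (hfix x hx)) fun μ hμ => hμ.1,
      hf.not_lowerSemicontinuousOn hΨ (hper.trans hsub) fun μ hμ => hμ.1⟩,
    ⟨hsub, hf.not_upperSemicontinuousOn hfix hber, hf.not_lowerSemicontinuousOn hΨ hper hber⟩,
    fun x hx => ⟨hfix x hx, fun m _ hm => hf.exists_bernoulli_tendsto hx hm⟩,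
    fun m _ hm μ hμ => ⟨hμ.entropy_eq, hf.bernoulli_mem_pseudoPhysical hm hμ,
      hf.exists_periodic_tendsto hΨ hm hμ⟩⟩
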